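/- **Setting.** A combinatorial rising bandit has $K$ base arms and a nonempty family $\mathcal S$ of super arms $S\subseteq[K]$; let $L=\max_{S\in\mathcal S}|S|$. The $n$-th pull of base arm $i$ has mean $\mu_i(n)\in[0,1]$, and the increments $\gamma_i(n)=\mu_i(n+1)-\mu_i(n)$, $n\ge1$, are nonnegative and nonincreasing in $n$. In every round $t=1,2,\dots$ a policy chooses $S_t\in\mathcal S$ on the basis of the past and observes an outcome for every $i\in S_t$. Given the past this outcome has mean $\mu_i(N_{i,t})$ and its deviation from the mean is $\sigma$-subgaussian, where $N_{i,t}$ is the number of pulls of $i$ in rounds $1,\dots,t$. The reward of a round is the sum of the outcomes of the base arms in $S_t$. The regret $R_{\vec\mu}(\pi,T)$ is the supremum over all policies of the expected cumulative reward of rounds $1,\dots,T$, minus that of $\pi$. For real $M$ and $q\in[0,1]$ put $$\Upsilon(M,q)=\sum_{1\le l<M}\max_{i\in[K]}\gamma_i(l)^q\qquad(0^0=1).$$ **Algorithm.** CRUCB with parameter $\varepsilon\in(0,1/2)$ uses in round $t$ the windows $h_i=\lfloor\varepsilon N_{i,t-1}\rfloor$ and, writing $X_i(l)$ for the outcome of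 the $l$-th pull of $i$, $$\hat\mu_i(t)=\frac1{h_i}\sum_{l=N_{i,t-1}-h_i+1}^{N_{i,t-1}}\Big(X_i(l)+(t-l)\frac{X_i(l)-X_i(l-h_i)}{h_i}\Big),\qquad \beta_i(t)=\sigma\,(t-N_{i,t-1}+h_i-1)\sqrt{\frac{10\log t^3}{h_i^3}}.$$ The index of $i$ is $\hat\mu_i(t)+\beta_i(t)$ if $h_i\ge1$, and $+\infty$ if $h_i=0$. CRUCB plays a super arm that maximizes $\sum_{i\in S}$ of the indices over $S\in\mathcal S$ (exact solver, arbitrary tie-breaking). **Theorem.** For all $K$, $\sigma\ge0$ and $\varepsilon\in(0,1/2)$ there is a constant $C=C(K,\sigma,\varepsilon)$ such that, for every combinatorial rising bandit with $K$ base arms and $\sigma$-subgaussian noise, every horizon $T$ and every $q\in[0,1]$, the supremum in the definition of the regret is finite and the regret of CRUCB satisfies $$R_{\vec\mu}(\mathrm{CRUCB},T)\;\le\;\frac{L\pi K}{3}+2K+L^{1-q}\,\frac{K\,T^{q}}{1-2\varepsilon}\,\Upsilon\Big((1-2\varepsilon)\frac{LT}{K},\,q\Big)+C\,T^{2/3}(\log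 T)^{1/3}.$$ -/

import Mathlib

open MeasureTheory

universe u

noncomputable section

/-- A combinatorial rising bandit problem with `K` base arms: a nonempty family of super arms
(sets of base arms) and, for each base arm `i`, the mean `mean i n` of the outcome of its `n`-th
pull (`n ≥ 1`; the value at `n = 0` plays no role). Means lie in `[0, 1]`, are nondecreasing in the
number of pulls and have nonincreasing increments. -/
structure RisingBandit (K : ℕ) where
  superArms : Finset (Finset (Fin K))
  superArms_nonempty : superArms.Nonempty
  mean : Fin K → ℕ → ℝ
  mean_nonneg : ∀ i n, 1 ≤ n → 0 ≤ mean i n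
  mean_le_one : ∀ i n, 1 ≤ n → mean i n ≤ 1
  rising : ∀ i n, 1 ≤ n → mean i n ≤ mean i (n + 1)
  concave : ∀ i n, 1 ≤ n → mean i (n + 2) - mean i (n + 1) ≤ mean i (n + 1) - mean i n

namespace RisingBandit

variable {K : ℕ}

/-- The increment `γ_i(n) = μ_i(n+1) - μ_i(n)`. -/
def increment (B : RisingBandit K) (i : Fin K) (n : ℕ) : ℝ := B.mean i (n + 1) - B.mean i n

/-- The cumulative increment `Υ(M, q) = ∑_{1 ≤ l < M} max_i γ_i(l)^q`, for real `M`. -/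
def cumIncrement (B : RisingBandit K) (M q : ℝ) : ℝ :=
  ∑ l ∈ Finset.Ico 1 ⌈M⌉₊, ⨆ i : Fin K, B.increment i l ^ q

/-- The maximal number `L` of base arms in a super arm. -/
def maxSize (B : RisingBandit K) : ℕ := B.superArms.sup Finset.card

end RisingBandit

/-- The number of rounds among `1, …, t` in which the super arm played contains `i`. -/
def pullCount {K : ℕ} {Ω : Type*} (S : ℕ → Ω → Finset (Fin K)) (i : Fin K) (t : ℕ) (ω : Ω) : ℕ :=
  ((Finset.Icc 1 t).filter fun s => i ∈ S s ω).card

/-- An interaction of some policy with the bandit problem `B` under `σ`-subgaussian noise.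
In round `t = 1, 2, …` the super arm `S t` is chosen on the basis of the information `ℱ (t-1)`
available before the round (observed outcomes, and possibly external randomization). For every
`i ∈ S t` an outcome `X t i` is then observed. Given the past its mean is the mean of the current
pull of `i`, and its deviation from this mean is `σ`-subgaussian. `X t i` is irrelevant when
`i ∉ S t`. -/
structure BanditRun {K : ℕ} (B : RisingBandit K) (σ : ℝ) where
  Ω : Type u
  [mΩ : MeasurableSpace Ω]
  P : Measure Ω
  [isProb : IsProbabilityMeasure P]
  ℱ : Filtration ℕ mΩ
  S : ℕ → Ω → Finset (Fin K)
  X : ℕ → Fin K → Ω → ℝ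
  S_mem : ∀ t ω, S (t + 1) ω ∈ B.superArms
  S_predictable : ∀ t i, MeasurableSet[ℱ t] {ω | i ∈ S (t + 1) ω}
  X_adapted : ∀ t i, Measurable[ℱ (t + 1)] ({ω | i ∈ S (t + 1) ω}.indicator (X (t + 1) i))
  X_integrable : ∀ t i, Integrable ({ω | i ∈ S (t + 1) ω}.indicator (X (t + 1) i)) P
  X_mean : ∀ t i, P[{ω | i ∈ S (t + 1) ω}.indicator (X (t + 1) i) | ℱ t] =ᵐ[P]
    {ω | i ∈ S (t + 1) ω}.indicator fun ω => B.mean i (pullCount S i (t + 1) ω)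
  X_integrable_exp : ∀ t i (θ : ℝ), Integrable (fun ω => Real.exp (θ *
    {ω | i ∈ S (t + 1) ω}.indicator
      (fun ω => X (t + 1) i ω - B.mean i (pullCount S i (t + 1) ω)) ω)) P
  X_subgaussian : ∀ t i (θ : ℝ), P[fun ω => Real.exp (θ *
    {ω | i ∈ S (t + 1) ω}.indicator
      (fun ω => X (t + 1) i ω - B.mean i (pullCount S i (t + 1) ω)) ω) | ℱ t] ≤ᵐ[P]
    fun _ => Real.exp (θ ^ 2 * σ ^ 2 / 2)

namespace BanditRun

variable {K : ℕ} {B : RisingBandit K} {σ : ℝ}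

attribute [instance] BanditRun.mΩ BanditRun.isProb

/-- The expected cumulative reward of the first `T` rounds; the reward of a super arm is the sum of
the outcomes of its base arms. -/
def value (R : BanditRun B σ) (T : ℕ) : ℝ :=
  ∫ ω, (∑ t ∈ Finset.Icc 1 T, ∑ i ∈ R.S t ω, R.X t i ω) ∂(R.P)

/-- The regret over `T` rounds: the optimal expected cumulative reward over all policies minus the
expected cumulative reward of the given one. -/
def regret (R : BanditRun.{u} B σ) (T : ℕ) : ℝ :=
  (⨆ R' : BanditRun.{u} B σ, R'.value T) - R.value T

/-- `N_{i,t}`, the number of pulls of base arm `i` up to and including round `t`. -/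
def pulls (R : BanditRun B σ) (i : Fin K) (t : ℕ) (ω : R.Ω) : ℕ := pullCount R.S i t ω

/-- The round in which base arm `i` is pulled for the `l`-th time (used only for pulls that have
taken place). -/
def pullRound (R : BanditRun B σ) (i : Fin K) (l : ℕ) (ω : R.Ω) : ℕ := sInf {t | l ≤ R.pulls i t ω}

/-- `X_i(l)`, the outcome of the `l`-th pull of base arm `i`. -/
def outcome (R : BanditRun B σ) (i : Fin K) (l : ℕ) (ω : R.Ω) : ℝ := R.X (R.pullRound i l ω) i ω

/-- The window size `h_i = ⌊ε N_{i,t-1}⌋` used in round `t`. -/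
def window (R : BanditRun B σ) (ε : ℝ) (i : Fin K) (t : ℕ) (ω : R.Ω) : ℕ :=
  ⌊ε * (R.pulls i (t - 1) ω : ℝ)⌋₊

/-- The sliding-window estimator
`(1/h) ∑_{l = N-h+1}^{N} (X_i(l) + (t - l) (X_i(l) - X_i(l-h)) / h)`, with `N = N_{i,t-1}`. -/
def estimate (R : BanditRun B σ) (ε : ℝ) (i : Fin K) (t : ℕ) (ω : R.Ω) : ℝ :=
  let N := R.pulls i (t - 1) ω
  let h := R.window ε i t ω
  (1 / (h : ℝ)) * ∑ l ∈ Finset.Icc (N - h + 1) N,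
    (R.outcome i l ω + ((t : ℝ) - l) * ((R.outcome i l ω - R.outcome i (l - h) ω) / h))

/-- The exploration bonus `σ (t - N_{i,t-1} + h - 1) √(10 log(t³) / h³)`. -/
def bonus (R : BanditRun B σ) (ε : ℝ) (i : Fin K) (t : ℕ) (ω : R.Ω) : ℝ :=
  let N := R.pulls i (t - 1) ω
  let h := R.window ε i t ω
  σ * ((t : ℝ) - N + h - 1) * Real.sqrt (10 * Real.log ((t : ℝ) ^ 3) / (h : ℝ) ^ 3)

/-- The optimistic index of a base arm, with value `+∞` as long as its window is empty. -/
def index (R : BanditRun B σ) (ε : ℝ) (i : Fin K) (t : ℕ) (ω : R.Ω) : EReal :=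
  if R.window ε i t ω = 0 then ⊤ else ((R.estimate ε i t ω + R.bonus ε i t ω : ℝ) : EReal)

/-- The run is one of the CRUCB algorithm: in every round an exact solver returns a super arm
that maximizes the sum of the indices of its base arms (ties are broken arbitrarily). -/
def IsCRUCB (R : BanditRun B σ) (ε : ℝ) : Prop :=
  ∀ t, 1 ≤ t → ∀ ω, ∀ S' ∈ B.superArms,
    ∑ i ∈ S', R.index ε i t ω ≤ ∑ i ∈ R.S t ω, R.index ε i t ω

end BanditRun

end

/-! An arm has at most `t` pulls by the end of round `t` and means rise, so no policy expects more
from round `t` than `bestReward t`, the best super arm with every arm at its `t`-th pull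
(`value_le`). CRUCB is compared with this benchmark by an optimism argument.

The estimator extrapolates each outcome of the window along the slope over the preceding `h` pulls.
By concavity past slopes dominate later ones, so without noise it overestimates `μ_i(t)`
(`mean_le_trend`), yet exceeds `μ_i(N)` by at most `t γ_i(N-2h+1)` (`trend_le`). Its noise is a sum
of conditionally subgaussian terms with predictable weights and stays within the bonus except with
probability of order `1/t²` (`measure_deviation_le`), so the bad rounds cost a bounded amount in
total. In a good round the loss is at most the `cost` summed over the arms played: an increment term
and twice the bonus, each clipped at `L`, or `L` if the window is empty (`bestReward_sub_le`).

Once `t` is bounded by `T`, the cost depends only on the pull count, and sums over rounds become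
sums over pulls (`sum_sum_mem_pulls`). Interpolation gives `min(L, Tγ) ≤ L^(1-q) T^q γ^q`; there are
at most `LT` pulls, and since partial sums of increments are concave the even split `LT/K` is
essentially the worst. This yields the `Υ` term (`sum_maxIncrement_le`). The bonuses are of order
`√(Q³/n³)` with `Q = T^(2/3) (log T)^(1/3)`; clipped at `L` they sum to `O(Q)` for each arm
(`sum_min_sqrt_le`). Since `Q ≥ 1` for `T ≥ 2`, all constants fit into `C Q`. -/

noncomputable section

/-! ### Concavity of the means and noise-free extrapolation. -/

namespace RisingBandit

variable {K : ℕ} (B : RisingBandit K)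

lemma increment_nonneg (i : Fin K) {n : ℕ} (hn : 1 ≤ n) : 0 ≤ B.increment i n :=
  sub_nonneg.2 (B.rising i n hn)

lemma increment_anti (i : Fin K) {m n : ℕ} (hm : 1 ≤ m) (hmn : m ≤ n) :
    B.increment i n ≤ B.increment i m := by
  induction n, hmn using Nat.le_induction with
  | base => exact le_rfl
  | succ n hmn ih => exact (B.concave i n (hm.trans hmn)).trans ih

lemma mean_mono (i : Fin K) {m n : ℕ} (hm : 1 ≤ m) (hmn : m ≤ n) : B.mean i m ≤ B.mean i n := by
  induction n, hmn using Nat.le_induction with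
  | base => exact le_rfl
  | succ n hmn ih => exact ih.trans (B.rising i n (hm.trans hmn))

lemma mean_sub_le (i : Fin K) {m : ℕ} (hm : 1 ≤ m) (k : ℕ) :
    B.mean i (m + k) - B.mean i m ≤ k * B.increment i m := by
  induction k with
  | zero => simp
  | succ k ih =>
    have h : B.mean i (m + k + 1) - B.mean i (m + k) ≤ B.increment i m :=
      B.increment_anti i hm (Nat.le_add_right m k)
    rw [← add_assoc]
    push_cast
    linarith

lemma succ_mul_increment_le (i : Fin K) {m : ℕ} (hm : 1 ≤ m) (k : ℕ) :
    (k + 1) * B.increment i (m + k) ≤ B.mean i (m + k + 1) - B.mean i m := by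
  induction k with
  | zero => simp [increment]
  | succ k ih =>
    have h := B.increment_anti i (m := m + k) (n := m + k + 1) (by omega) (by omega)
    have h2 : B.increment i (m + k + 1) = B.mean i (m + k + 1 + 1) - B.mean i (m + k + 1) := rfl
    have h3 := mul_le_mul_of_nonneg_left h (by positivity : (0 : ℝ) ≤ k + 1)
    rw [← add_assoc]
    push_cast
    linarith

lemma mul_increment_le (i : Fin K) {m : ℕ} (hm : 1 ≤ m) (k : ℕ) :
    k * B.increment i (m + k) ≤ B.mean i (m + k) - B.mean i m := by
  cases k with
  | zero => simp
  | succ k =>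
    have h := B.increment_anti i (m := m + k) (n := m + k + 1) (by omega) (by omega)
    have h3 := mul_le_mul_of_nonneg_left h (by positivity : (0 : ℝ) ≤ k + 1)
    have := B.succ_mul_increment_le i hm k
    rw [← add_assoc]
    push_cast
    linarith

/-- The increments `γ(1), …, γ(n)` are all at least `γ(n)` and add up to at most `1`. This decay
makes the boundary terms harmless later on. -/
lemma increment_le_inv (i : Fin K) {n : ℕ} (hn : 1 ≤ n) : B.increment i n ≤ (n : ℝ)⁻¹ := by
  obtain ⟨k, rfl⟩ := Nat.exists_eq_add_of_le hn
  have h := B.succ_mul_increment_le i le_rfl k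
  have h1 := B.mean_le_one i (1 + k + 1) (by omega)
  have h2 := B.mean_nonneg i 1 le_rfl
  rw [← one_div, le_div_iff₀ (by positivity)]
  push_cast
  linarith

/-- The noise-free version of the sliding-window estimator after `n` pulls with window `h`. -/
def trend (i : Fin K) (t n h : ℕ) : ℝ :=
  (1 / (h : ℝ)) * ∑ l ∈ Finset.Icc (n - h + 1) n,
    (B.mean i l + ((t : ℝ) - l) * ((B.mean i l - B.mean i (l - h)) / h))

variable {B}

/-- By concavity the average slope over `[l-h, l]` is at least `γ(l)`, which dominates every later
increment, so each summand already lies above `μ(t)`. The condition `2h ≤ n` keeps `l - h ≥ 1`. -/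
lemma mean_le_trend (i : Fin K) {t n h : ℕ} (hh : 1 ≤ h) (hn : 2 * h ≤ n) (ht : n ≤ t) :
    B.mean i t ≤ B.trend i t n h := by
  have hh' : (0 : ℝ) < h := by exact_mod_cast hh
  have key : ∀ l ∈ Finset.Icc (n - h + 1) n, B.mean i t ≤
      B.mean i l + ((t : ℝ) - l) * ((B.mean i l - B.mean i (l - h)) / h) := by
    intro l hl
    rw [Finset.mem_Icc] at hl
    have h1 := B.mul_increment_le i (m := l - h) (by omega) h
    rw [Nat.sub_add_cancel (by omega)] at h1
    have h2 := B.mean_sub_le i (m := l) (by omega) (t - l)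
    rw [Nat.add_sub_cancel' (by omega), Nat.cast_sub (by omega)] at h2
    have h3 : B.increment i l ≤ (B.mean i l - B.mean i (l - h)) / h := by
      rw [le_div_iff₀ hh']; linarith
    have h4 : (l : ℝ) ≤ t := by exact_mod_cast (by omega : l ≤ t)
    have := mul_le_mul_of_nonneg_left h3 (sub_nonneg.2 h4)
    linarith
  have hs := Finset.card_nsmul_le_sum _ _ _ key
  rw [Nat.card_Icc, show n + 1 - (n - h + 1) = h by omega, nsmul_eq_mul] at hs
  rw [trend, one_div, inv_mul_eq_div, le_div_iff₀ hh']
  linarith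

/-- The oldest pull entering the window slopes is `n - 2h + 1`, and its increment dominates all of
these slopes. -/
lemma trend_le (i : Fin K) {t n h : ℕ} (hh : 1 ≤ h) (hn : 2 * h ≤ n) (ht : n ≤ t) :
    B.trend i t n h ≤ B.mean i n + t * B.increment i (n - 2 * h + 1) := by
  have hh' : (0 : ℝ) < h := by exact_mod_cast hh
  have key : ∀ l ∈ Finset.Icc (n - h + 1) n,
      B.mean i l + ((t : ℝ) - l) * ((B.mean i l - B.mean i (l - h)) / h) ≤
        B.mean i n + t * B.increment i (n - 2 * h + 1) := by
    intro l hl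
    rw [Finset.mem_Icc] at hl
    have h1 := B.mean_sub_le i (m := l - h) (by omega) h
    rw [Nat.sub_add_cancel (by omega)] at h1
    have h2 := B.mean_mono i (m := l) (n := n) (by omega) hl.2
    have h3 : (B.mean i l - B.mean i (l - h)) / h ≤ B.increment i (l - h) := by
      rw [div_le_iff₀ hh']; linarith
    have h5 := B.increment_anti i (m := n - 2 * h + 1) (n := l - h) (by omega) (by omega)
    have h6 := B.increment_nonneg i (n := n - 2 * h + 1) (by omega)
    have h4 : (l : ℝ) ≤ t := by exact_mod_cast (by omega : l ≤ t)
    have h7 := mul_le_mul_of_nonneg_left (h3.trans h5) (sub_nonneg.2 h4)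
    have h8 := mul_nonneg (Nat.cast_nonneg (α := ℝ) l) h6
    linarith
  have hs := Finset.sum_le_card_nsmul _ _ _ key
  rw [Nat.card_Icc, show n + 1 - (n - h + 1) = h by omega, nsmul_eq_mul] at hs
  rw [trend, one_div, inv_mul_eq_div, div_le_iff₀ hh']
  linarith

variable (B)

lemma card_le_maxSize {S : Finset (Fin K)} (hS : S ∈ B.superArms) : S.card ≤ B.maxSize :=
  Finset.le_sup (f := Finset.card) hS

/-- The largest `q`-th power of an increment, `max_i γ_i(l)^q`. -/
def maxIncrement (q : ℝ) (l : ℕ) : ℝ := ⨆ i : Fin K, B.increment i l ^ q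

lemma increment_rpow_le_maxIncrement (q : ℝ) (i : Fin K) (l : ℕ) :
    B.increment i l ^ q ≤ B.maxIncrement q l :=
  le_ciSup (f := fun i => B.increment i l ^ q) (Set.finite_range _).bddAbove i

lemma maxIncrement_nonneg (q : ℝ) {l : ℕ} (hl : 1 ≤ l) : 0 ≤ B.maxIncrement q l :=
  Real.iSup_nonneg fun i => Real.rpow_nonneg (B.increment_nonneg i hl) q

lemma maxIncrement_anti {q : ℝ} (hq : 0 ≤ q) {m n : ℕ} (hm : 1 ≤ m) (hmn : m ≤ n) :
    B.maxIncrement q n ≤ B.maxIncrement q m :=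
  Real.iSup_le (fun i => (Real.rpow_le_rpow (B.increment_nonneg i (hm.trans hmn))
    (B.increment_anti i hm hmn) hq).trans (B.increment_rpow_le_maxIncrement q i m))
    (B.maxIncrement_nonneg q hm)

lemma maxIncrement_le {q : ℝ} (hq : 0 ≤ q) {x : ℝ} (hx : 0 < x) {l : ℕ} (hl : x ≤ l) :
    B.maxIncrement q l ≤ x⁻¹ ^ q := by
  have h1 : 1 ≤ l := Nat.cast_pos.1 (hx.trans_le hl)
  exact Real.iSup_le (fun i => Real.rpow_le_rpow (B.increment_nonneg i h1)
    ((B.increment_le_inv i h1).trans (inv_anti₀ hx hl)) hq) (by positivity)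

lemma cumIncrement_nonneg (M q : ℝ) : 0 ≤ B.cumIncrement M q :=
  Finset.sum_nonneg fun _ hl => B.maxIncrement_nonneg q (Finset.mem_Ico.1 hl).1

end RisingBandit

/-! ### Summation inequalities for increments and clipped bonuses. -/

/-- Discrete tangent inequality for the partial sums of an antitone sequence. -/
lemma sum_range_le_tangent {f : ℕ → ℝ} (hf : Antitone f) (m n : ℕ) :
    ∑ k ∈ Finset.range n, f k ≤ ∑ k ∈ Finset.range m, f k + ((n : ℝ) - m) * f m := by
  rcases le_total m n with h | h
  · induction n, h using Nat.le_induction with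
    | base => simp
    | succ n h ih =>
      rw [Finset.sum_range_succ]
      push_cast
      linarith [hf h]
  · induction m, h using Nat.le_induction with
    | base => simp
    | succ m h ih =>
      rw [Finset.sum_range_succ]
      push_cast
      have h1 : (n : ℝ) ≤ m := by exact_mod_cast h
      nlinarith [hf (Nat.le_succ m)]

/-- Slowing down an antitone sequence by a factor `a` multiplies its sum by at most `1 / a`. -/
lemma sum_floor_le {g : ℕ → ℝ} (hg : Antitone g) {a : ℝ} (ha : 0 < a) (m : ℕ) (hg0 : ∀ n, 0 ≤ g n) :
    ∑ n ∈ Finset.range m, g ⌊a * ((n + 1 : ℕ) : ℝ)⌋₊ ≤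
      1 / a * ∑ l ∈ Finset.range ⌈a * m⌉₊, g l := by
  have hG : AntitoneOn (fun x : ℝ => g ⌊x⌋₊) Set.univ :=
    fun x _ y _ hxy => hg (Nat.floor_mono hxy)
  have hF : AntitoneOn (fun x : ℝ => g ⌊a * x⌋₊) Set.univ := fun x _ y _ hxy =>
    hg (Nat.floor_mono (mul_le_mul_of_nonneg_left hxy ha.le))
  -- Both sums are compared with integrals of the step function `g ⌊·⌋₊`; the substitution `x ↦ a x`
  -- produces the factor `1 / a`.
  have h1 := (hF.mono (Set.subset_univ (Set.Icc (0 : ℝ) (0 + m)))).sum_le_integral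
  have h2 := (hG.mono (Set.subset_univ (Set.Icc (0 : ℝ) (0 + ⌈a * m⌉₊)))).integral_le_sum
  have h3 : ∫ x in (0 : ℝ)..(0 + m), g ⌊a * x⌋₊ = a⁻¹ * ∫ x in (0 : ℝ)..(a * m), g ⌊x⌋₊ := by
    rw [intervalIntegral.integral_comp_mul_left (fun x => g ⌊x⌋₊) ha.ne']
    simp
  have h4 : ∫ x in (0 : ℝ)..(a * m), g ⌊x⌋₊ ≤ ∫ x in (0 : ℝ)..(0 + ⌈a * m⌉₊), g ⌊x⌋₊ := by
    refine intervalIntegral.integral_mono_interval le_rfl (by positivity)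
      (by rw [zero_add]; exact Nat.le_ceil _) (Filter.Eventually.of_forall fun x => hg0 _) ?_
    exact (hG.mono (Set.subset_univ _)).intervalIntegrable
  simp only [zero_add, Nat.floor_natCast] at h1 h2 h3 h4
  rw [one_div]
  calc _ ≤ _ := h1
    _ = _ := h3
    _ ≤ _ := mul_le_mul_of_nonneg_left (h4.trans h2) (by positivity)

/-- The minimum is the product of its own powers `1 - q` and `q`. This is the source of the
exponents of `L` and `T` in the regret bound. -/
lemma min_le_rpow_mul_rpow {c x q : ℝ} (hc : 0 ≤ c) (hx : 0 ≤ x) (hq0 : 0 ≤ q) (hq1 : q ≤ 1) :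
    min c x ≤ c ^ (1 - q) * x ^ q := by
  have hm : 0 ≤ min c x := le_min hc hx
  calc min c x = min c x ^ (1 - q) * min c x ^ q := by
        rw [← Real.rpow_add_of_nonneg hm (by linarith) hq0]; simp
    _ ≤ _ := mul_le_mul (Real.rpow_le_rpow hm (min_le_left _ _) (by linarith))
        (Real.rpow_le_rpow hm (min_le_right _ _) hq0) (by positivity) (by positivity)

lemma min_sum_le {ι : Type*} (s : Finset ι) {c : ℝ} (hc : 0 ≤ c) {f : ι → ℝ}
    (hf : ∀ i ∈ s, 0 ≤ f i) : min c (∑ i ∈ s, f i) ≤ ∑ i ∈ s, min c (f i) := by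
  by_cases h : ∃ i ∈ s, c ≤ f i
  · obtain ⟨i, hi, hci⟩ := h
    refine (min_le_left _ _).trans ((le_min le_rfl hci).trans ?_)
    exact Finset.single_le_sum (f := fun i => min c (f i)) (fun j hj => le_min hc (hf j hj)) hi
  · push Not at h
    rw [Finset.sum_congr rfl fun i hi => min_eq_right (h i hi).le]
    exact min_le_right _ _

/-- A telescoping bound for `j^(-3/2)`, the discrete form of integrating it to `-2 j^(-1/2)`. -/
lemma inv_mul_sqrt_succ_le {x : ℝ} (hx : 0 < x) :
    ((x + 1) * √(x + 1))⁻¹ ≤ 2 * (√x)⁻¹ - 2 * (√(x + 1))⁻¹ := by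
  have hu := Real.sqrt_pos.2 hx
  have hv := Real.sqrt_pos.2 (by linarith : 0 < x + 1)
  have hu2 := Real.sq_sqrt hx.le
  have hv2 := Real.sq_sqrt (by linarith : 0 ≤ x + 1)
  have huv : √x ≤ √(x + 1) := Real.sqrt_le_sqrt (by linarith)
  set u := √x
  set v := √(x + 1)
  have h1 : 2 * u⁻¹ - 2 * v⁻¹ = 2 / ((u + v) * (u * v)) := by
    have : (v - u) * (v + u) = 1 := by nlinarith
    field_simp
    linarith
  rw [h1, ← hv2, ← one_div, div_le_div_iff₀ (by positivity) (by positivity)]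
  nlinarith [mul_nonneg hu.le (sub_nonneg.2 huv), mul_pos hu hv]

lemma sum_inv_mul_sqrt_le {k : ℕ} (hk : 1 ≤ k) (m : ℕ) :
    ∑ j ∈ Finset.Ico (k + 1) (k + 1 + m), ((j : ℝ) * √j)⁻¹ ≤ 2 * (√k)⁻¹ - 2 * (√(k + m : ℕ))⁻¹ := by
  induction m with
  | zero => simp
  | succ m ih =>
    rw [← add_assoc, Finset.sum_Ico_succ_top (by omega)]
    have h := inv_mul_sqrt_succ_le (x := ((k + m : ℕ) : ℝ)) (by positivity)
    rw [show k + 1 + m = k + m + 1 by omega] at ih ⊢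
    rw [← add_assoc]
    push_cast at *
    linarith

/-- Sum of the clipped bonuses. -/
lemma sum_min_sqrt_le {c A Q : ℝ} (hc : 0 ≤ c) (hA : 0 ≤ A) (hQ : 1 ≤ Q) (n : ℕ) :
    ∑ j ∈ Finset.Ico 1 n, min c (A * √(Q ^ 3 / (j : ℝ) ^ 3)) ≤ (2 * c + 2 * A) * Q := by
  -- Near `Q` the square root drops below `1`. Up to there the clip `c` is used, about `Q` times;
  -- beyond, the tail of `Q^(3/2) j^(-3/2)` is again of order `Q`.
  set k := ⌈Q⌉₊ with hk
  have hQk : Q ≤ k := Nat.le_ceil Q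
  have hkQ : (k : ℝ) ≤ Q + 1 := (Nat.ceil_lt_add_one (by linarith)).le
  have hk1 : 1 ≤ k := Nat.one_le_ceil_iff.2 (by linarith)
  have hpos : ∀ j : ℕ, 0 ≤ min c (A * √(Q ^ 3 / (j : ℝ) ^ 3)) := fun j => le_min hc (by positivity)
  have h1 : ∑ j ∈ Finset.Ico 1 (k + 1), min c (A * √(Q ^ 3 / (j : ℝ) ^ 3)) ≤ k * c := by
    refine (Finset.sum_le_card_nsmul _ _ c fun j _ => min_le_left _ _).trans ?_
    simp
  have h2 : ∑ j ∈ Finset.Ico (k + 1) (k + 1 + n), min c (A * √(Q ^ 3 / (j : ℝ) ^ 3)) ≤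
      2 * A * Q := by
    have hs : ∀ x : ℝ, 0 ≤ x → √(x ^ 3) = x * √x := fun x hx => by
      rw [pow_succ, Real.sqrt_mul (by positivity), Real.sqrt_sq hx]
    have hQs : 0 < √Q := Real.sqrt_pos.2 (by linarith)
    calc _ ≤ ∑ j ∈ Finset.Ico (k + 1) (k + 1 + n), A * (Q * √Q) * ((j : ℝ) * √j)⁻¹ := by
          refine Finset.sum_le_sum fun j _ => (min_le_right _ _).trans (le_of_eq ?_)
          rw [Real.sqrt_div (by positivity), hs _ (by linarith), hs _ (by positivity)]
          ring
      _ ≤ A * (Q * √Q) * (2 * (√Q)⁻¹) := by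
          rw [← Finset.mul_sum]
          refine mul_le_mul_of_nonneg_left ((sum_inv_mul_sqrt_le hk1 n).trans ?_) (by positivity)
          have : (√k)⁻¹ ≤ (√Q)⁻¹ := inv_anti₀ hQs (Real.sqrt_le_sqrt hQk)
          have : 0 ≤ (√(k + n : ℕ))⁻¹ := by positivity
          linarith
      _ = 2 * A * Q := by field_simp
  have h3 : ∑ j ∈ Finset.Ico 1 n, min c (A * √(Q ^ 3 / (j : ℝ) ^ 3)) ≤
      ∑ j ∈ Finset.Ico 1 (k + 1 + n), min c (A * √(Q ^ 3 / (j : ℝ) ^ 3)) :=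
    Finset.sum_le_sum_of_subset_of_nonneg
      (Finset.Ico_subset_Ico_right (by omega)) fun j _ _ => hpos j
  rw [← Finset.sum_Ico_consecutive _ (by omega : 1 ≤ k + 1) (by omega : k + 1 ≤ k + 1 + n)] at h3
  have h4 : (k : ℝ) * c ≤ (Q + 1) * c := mul_le_mul_of_nonneg_right hkQ hc
  nlinarith

/-- The increments collected at the pull counts `N i`, slowed down by the factor `a`, are dominated
by the cumulative increment up to the average pull count. -/
lemma RisingBandit.sum_maxIncrement_le {K : ℕ} (B : RisingBandit K) (hK : 0 < K) {q : ℝ}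
    (hq : 0 ≤ q) {a : ℝ} (ha : 0 < a) {x : ℝ} (hx : 0 < x) (N : Fin K → ℕ)
    (hN : ∑ i, (N i : ℝ) ≤ x) :
    ∑ i, ∑ n ∈ Finset.range (N i), B.maxIncrement q (⌊a * ((n + 1 : ℕ) : ℝ)⌋₊ + 1) ≤
      K * (1 / a * B.cumIncrement (a * (x / K)) q) + (K / a + K) * (a * (x / K))⁻¹ ^ q := by
  have hK' : (0 : ℝ) < K := by exact_mod_cast hK
  set M := x / K with hM
  have hM0 : 0 < M := by positivity
  set m := ⌊M⌋₊
  have hmM : (m : ℝ) ≤ M := Nat.floor_le hM0.le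
  have hMm : M < m + 1 := Nat.lt_floor_add_one M
  have hg : Antitone fun l => B.maxIncrement q (l + 1) := fun _ _ h =>
    B.maxIncrement_anti hq (Nat.le_add_left 1 _) (Nat.succ_le_succ h)
  have hg0 : ∀ l, 0 ≤ B.maxIncrement q (l + 1) := fun l =>
    B.maxIncrement_nonneg q (Nat.le_add_left 1 _)
  have hE : Antitone fun n : ℕ => B.maxIncrement q (⌊a * ((n + 1 : ℕ) : ℝ)⌋₊ + 1) := fun _ _ h =>
    hg (Nat.floor_mono (mul_le_mul_of_nonneg_left
      (by exact_mod_cast Nat.succ_le_succ h) ha.le))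
  have hEm : B.maxIncrement q (⌊a * ((m + 1 : ℕ) : ℝ)⌋₊ + 1) ≤ (a * M)⁻¹ ^ q := by
    refine B.maxIncrement_le hq (by positivity) ?_
    refine le_trans ?_ ((Nat.lt_floor_add_one _).le.trans_eq (Nat.cast_succ _).symm)
    push_cast
    exact mul_le_mul_of_nonneg_left hMm.le ha.le
  have hsum : ∑ n ∈ Finset.range m, B.maxIncrement q (⌊a * ((n + 1 : ℕ) : ℝ)⌋₊ + 1) ≤
      1 / a * (B.cumIncrement (a * M) q + (a * M)⁻¹ ^ q) := by
    refine (sum_floor_le hg ha m hg0).trans (mul_le_mul_of_nonneg_left ?_ (by positivity))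
    have h1 : ∑ l ∈ Finset.range ⌈a * m⌉₊, B.maxIncrement q (l + 1) ≤
        ∑ l ∈ Finset.range ⌈a * M⌉₊, B.maxIncrement q (l + 1) :=
      Finset.sum_le_sum_of_subset_of_nonneg (Finset.range_subset_range.2
        (Nat.ceil_mono (mul_le_mul_of_nonneg_left hmM ha.le))) fun l _ _ => hg0 l
    refine h1.trans ?_
    have h2 : 1 ≤ ⌈a * M⌉₊ := Nat.one_le_ceil_iff.2 (by positivity)
    have h3 : ∑ l ∈ Finset.range ⌈a * M⌉₊, B.maxIncrement q (l + 1) =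
        ∑ l ∈ Finset.Ico 1 (⌈a * M⌉₊ + 1), B.maxIncrement q l := by
      rw [Finset.sum_Ico_eq_sum_range]
      simp [add_comm]
    -- The shift `l + 1` produces one term more than `cumIncrement` contains; it sits at `⌈a M⌉` and
    -- is bounded by the decay of increments.
    rw [h3, Finset.sum_Ico_succ_top h2]
    exact add_le_add le_rfl (B.maxIncrement_le hq (by positivity) (Nat.le_ceil _))
  have hEm0 := hg0 ⌊a * ((m + 1 : ℕ) : ℝ)⌋₊
  have hx1 : x - K * m ≤ K := by
    have : x = K * M := by rw [hM]; field_simp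
    rw [this]
    nlinarith
  -- The tangents are all taken at the same point `m = ⌊x / K⌋`, so the individual counts `N i`
  -- enter only through their total.
  calc _ ≤ ∑ i : Fin K, (∑ n ∈ Finset.range m, B.maxIncrement q (⌊a * ((n + 1 : ℕ) : ℝ)⌋₊ + 1)
          + ((N i : ℝ) - m) * B.maxIncrement q (⌊a * ((m + 1 : ℕ) : ℝ)⌋₊ + 1)) :=
        Finset.sum_le_sum fun i _ => sum_range_le_tangent hE m (N i)
    _ = K * ∑ n ∈ Finset.range m, B.maxIncrement q (⌊a * ((n + 1 : ℕ) : ℝ)⌋₊ + 1)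
          + (∑ i, (N i : ℝ) - K * m) * B.maxIncrement q (⌊a * ((m + 1 : ℕ) : ℝ)⌋₊ + 1) := by
        rw [Finset.sum_add_distrib, ← Finset.sum_mul, Finset.sum_sub_distrib]
        simp
    _ ≤ K * (1 / a * (B.cumIncrement (a * M) q + (a * M)⁻¹ ^ q)) + K * (a * M)⁻¹ ^ q := by
        refine add_le_add (mul_le_mul_of_nonneg_left hsum hK'.le) ?_
        refine (mul_le_mul_of_nonneg_right (by linarith) hEm0).trans
          (mul_le_mul_of_nonneg_left hEm hK'.le)
    _ = _ := by ring

/-! ### Concentration of noise weighted by pull ordinals. -/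

/-- A conditional expectation bound can be used inside a lower Lebesgue integral, against any
nonnegative factor that is measurable for the conditioning σ-algebra. -/
lemma lintegral_mul_le_of_condExp_le {Ω : Type*} {m m0 : MeasurableSpace Ω} (hm : m ≤ m0)
    {P : Measure Ω} [IsFiniteMeasure P] {f : Ω → ENNReal} (hf : Measurable[m] f)
    {g : Ω → ℝ} (hg : Integrable g P) (hg0 : ∀ ω, 0 ≤ g ω) {c : ℝ}
    (hc : P[g | m] ≤ᵐ[P] fun _ => c) :
    ∫⁻ ω, f ω * ENNReal.ofReal (g ω) ∂P ≤ ENNReal.ofReal c * ∫⁻ ω, f ω ∂P := by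
  -- On sets of `m` the measure with density `g` is at most `c P`, and an `m`-measurable `f` sees
  -- only these sets. Lower integrals avoid any integrability assumption on the product.
  set ν := P.withDensity fun ω => ENNReal.ofReal (g ω) with hν
  have hle : ν.trim hm ≤ (ENNReal.ofReal c • P).trim hm := by
    refine Measure.le_iff.2 fun s hs => ?_
    rw [trim_measurableSet_eq hm hs, trim_measurableSet_eq hm hs, hν,
      withDensity_apply _ (hm s hs), ← ofReal_integral_eq_lintegral_ofReal hg.integrableOn
        (Filter.Eventually.of_forall hg0), ← setIntegral_condExp hm hg hs,
      Measure.smul_apply, smul_eq_mul]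
    have h1 : ∫ ω in s, (P[g | m]) ω ∂P ≤ ∫ _ in s, c ∂P :=
      integral_mono_ae integrable_condExp.integrableOn (integrable_const c)
        (ae_restrict_of_ae hc)
    refine (ENNReal.ofReal_le_ofReal h1).trans ?_
    rw [setIntegral_const, smul_eq_mul, mul_comm, ENNReal.ofReal_mul' (by positivity),
      Measure.real, ENNReal.ofReal_toReal (measure_ne_top _ _)]
  have hf0 : Measurable f := hf.mono hm le_rfl
  calc ∫⁻ ω, f ω * ENNReal.ofReal (g ω) ∂P = ∫⁻ ω, f ω ∂ν := by
        rw [hν, lintegral_withDensity_eq_lintegral_mul₀ hg.aemeasurable.ennreal_ofReal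
          hf0.aemeasurable]
        simp [mul_comm]
    _ = ∫⁻ ω, f ω ∂(ν.trim hm) := (lintegral_trim hm hf).symm
    _ ≤ ∫⁻ ω, f ω ∂((ENNReal.ofReal c • P).trim hm) := lintegral_mono' hle le_rfl
    _ = _ := by rw [lintegral_trim hm hf, lintegral_smul_measure, smul_eq_mul]

namespace BanditRun

variable {K : ℕ} {B : RisingBandit K} {σ : ℝ} (R : BanditRun.{u} B σ)

lemma pulls_zero (i : Fin K) (ω : R.Ω) : R.pulls i 0 ω = 0 := by simp [pulls, pullCount]

open Classical in
lemma pulls_succ (i : Fin K) (t : ℕ) (ω : R.Ω) :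
    R.pulls i (t + 1) ω = R.pulls i t ω + if i ∈ R.S (t + 1) ω then 1 else 0 := by
  unfold pulls pullCount
  simp only [Finset.card_filter]
  exact Finset.sum_Icc_succ_top (by omega) _

lemma pulls_le (i : Fin K) (t : ℕ) (ω : R.Ω) : R.pulls i t ω ≤ t := by
  simpa [pulls, pullCount] using Finset.card_filter_le (Finset.Icc 1 t) fun s => i ∈ R.S s ω

lemma pulls_mono (i : Fin K) (ω : R.Ω) : Monotone fun t => R.pulls i t ω :=
  monotone_nat_of_le_succ fun t => by rw [pulls_succ]; omega

lemma measurable_pulls (i : Fin K) (t : ℕ) : Measurable[R.ℱ (t - 1)] (R.pulls i t) := by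
  induction t with
  | zero =>
    have : R.pulls i 0 = fun _ => 0 := funext (R.pulls_zero i)
    rw [this]; exact measurable_const
  | succ t ih =>
    classical
    have : R.pulls i (t + 1) = fun ω => R.pulls i t ω + if i ∈ R.S (t + 1) ω then 1 else 0 :=
      funext (R.pulls_succ i t)
    rw [this]
    refine (ih.mono (R.ℱ.mono (by omega)) le_rfl).add ?_
    exact Measurable.ite (R.S_predictable t i) measurable_const measurable_const

/-- The deviation of the outcome of round `t` from its mean (zero if `i` is not pulled). -/
def noise (t : ℕ) (i : Fin K) : R.Ω → ℝ :=
  {ω | i ∈ R.S t ω}.indicator fun ω => R.X t i ω - B.mean i (R.pulls i t ω)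

open Classical in
/-- The ordinal of the pull of `i` in round `t`, with value `0` if `i` is not pulled. -/
def label (t : ℕ) (i : Fin K) (ω : R.Ω) : ℕ := if i ∈ R.S t ω then R.pulls i t ω else 0

lemma measurable_mean_pulls (i : Fin K) (t : ℕ) :
    Measurable[R.ℱ t] fun ω => B.mean i (R.pulls i (t + 1) ω) :=
  (measurable_from_nat (f := B.mean i)).comp (R.measurable_pulls i (t + 1))

lemma measurable_noise (t : ℕ) (i : Fin K) : Measurable[R.ℱ (t + 1)] (R.noise (t + 1) i) := by
  have h : R.noise (t + 1) i = {ω | i ∈ R.S (t + 1) ω}.indicator (R.X (t + 1) i) -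
      {ω | i ∈ R.S (t + 1) ω}.indicator fun ω => B.mean i (R.pulls i (t + 1) ω) :=
    Set.indicator_sub _ _ _
  rw [h]
  refine (R.X_adapted t i).sub (Measurable.indicator ?_ (R.ℱ.mono (Nat.le_succ t) _ (R.S_predictable t i)))
  exact (R.measurable_mean_pulls i t).mono (R.ℱ.mono (Nat.le_succ t)) le_rfl

lemma measurable_label (t : ℕ) (i : Fin K) : Measurable[R.ℱ t] (R.label (t + 1) i) := by
  classical
  exact Measurable.ite (R.S_predictable t i) (R.measurable_pulls i (t + 1)) measurable_const

lemma label_le (t : ℕ) (i : Fin K) (ω : R.Ω) : R.label t i ω ≤ t := by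
  unfold label
  split_ifs
  · exact R.pulls_le i t ω
  · exact Nat.zero_le _

/-- Noise of the first `t` rounds, weighted according to the ordinal of the pull. -/
def weightedNoise (c : ℕ → ℝ) (i : Fin K) (t : ℕ) (ω : R.Ω) : ℝ :=
  ∑ r ∈ Finset.range t, c (R.label (r + 1) i ω) * R.noise (r + 1) i ω

lemma measurable_weightedNoise (c : ℕ → ℝ) (i : Fin K) (t : ℕ) :
    Measurable[R.ℱ t] (R.weightedNoise c i t) := by
  refine Finset.measurable_fun_sum _ fun r hr => ?_
  have hr := Finset.mem_range.1 hr
  refine Measurable.mul ?_ ((R.measurable_noise r i).mono (R.ℱ.mono (by omega)) le_rfl)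
  exact (measurable_from_nat (f := c)).comp
    ((R.measurable_label r i).mono (R.ℱ.mono hr.le) le_rfl)

/-- The conditional variance proxy of the weighted noise. -/
def weightSum (c : ℕ → ℝ) (i : Fin K) (t : ℕ) (ω : R.Ω) : ℝ :=
  ∑ r ∈ Finset.range t, c (R.label (r + 1) i ω) ^ 2

lemma measurable_weightSum (c : ℕ → ℝ) (i : Fin K) (t : ℕ) :
    Measurable[R.ℱ t] (R.weightSum c i t) := by
  refine Finset.measurable_fun_sum _ fun r hr => ?_
  have hr := Finset.mem_range.1 hr
  exact (measurable_from_nat (f := fun k => c k ^ 2)).comp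
    ((R.measurable_label r i).mono (R.ℱ.mono hr.le) le_rfl)

lemma lintegral_mul_exp_noise_le (c : ℕ → ℝ) (i : Fin K) (t : ℕ) {f : R.Ω → ENNReal}
    (hf : Measurable[R.ℱ t] f) :
    ∫⁻ ω, f ω * ENNReal.ofReal (Real.exp (c (R.label (t + 1) i ω) * R.noise (t + 1) i ω)) ∂(R.P) ≤
      ∫⁻ ω, f ω * ENNReal.ofReal (Real.exp (c (R.label (t + 1) i ω) ^ 2 * σ ^ 2 / 2)) ∂(R.P) := by
  -- The subgaussian hypothesis concerns a deterministic `θ`, whereas the weight depends on the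
  -- random label. The label is predictable and takes finitely many values, so splitting along it
  -- makes the weight constant on each piece.
  set A : ℕ → Set R.Ω := fun k => {ω | R.label (t + 1) i ω = k} with hA
  have hAm : ∀ k, MeasurableSet[R.ℱ t] (A k) := fun k =>
    R.measurable_label t i (measurableSet_singleton k)
  have hsplit : ∀ F : ℕ → R.Ω → ENNReal, ∀ ω, f ω * F (R.label (t + 1) i ω) ω =
      ∑ k ∈ Finset.range (t + 2), (A k).indicator f ω * F k ω := by
    intro F ω
    rw [Finset.sum_eq_single (R.label (t + 1) i ω)]
    · simp [hA]
    · intro k _ hk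
      simp [hA, hk.symm]
    · intro h
      exact absurd (Finset.mem_range.2 (Nat.lt_succ_of_le (R.label_le (t + 1) i ω))) h
  simp_rw [hsplit fun k ω => ENNReal.ofReal (Real.exp (c k * R.noise (t + 1) i ω)),
    hsplit fun k _ => ENNReal.ofReal (Real.exp (c k ^ 2 * σ ^ 2 / 2))]
  have hfm : ∀ k, Measurable ((A k).indicator f) := fun k =>
    (hf.indicator (hAm k)).mono (R.ℱ.le t) le_rfl
  have hnm : Measurable (R.noise (t + 1) i) := (R.measurable_noise t i).mono (R.ℱ.le _) le_rfl
  rw [lintegral_finsetSum _ fun k _ => by have := hfm k; fun_prop,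
    lintegral_finsetSum _ fun k _ => by have := hfm k; fun_prop]
  refine Finset.sum_le_sum fun k _ => ?_
  rw [lintegral_mul_const _ (hfm k), mul_comm (lintegral _ _)]
  exact lintegral_mul_le_of_condExp_le (R.ℱ.le t) (hf.indicator (hAm k))
    (R.X_integrable_exp t i (c k)) (fun _ => (Real.exp_pos _).le) (R.X_subgaussian t i (c k))

/-- The compensated exponential is a supermartingale started at `1`. -/
lemma lintegral_exp_weightedNoise_sub_le (c : ℕ → ℝ) (i : Fin K) (t : ℕ) :
    ∫⁻ ω, ENNReal.ofReal (Real.exp (R.weightedNoise c i t ω - R.weightSum c i t ω * σ ^ 2 / 2))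
      ∂(R.P) ≤ 1 := by
  induction t with
  | zero => simp [weightedNoise, weightSum]
  | succ t ih =>
    -- Everything known before the outcome of round `t + 1`, including its variance term, since the
    -- label is predictable.
    set f : R.Ω → ENNReal := fun ω => ENNReal.ofReal (Real.exp (R.weightedNoise c i t ω -
      R.weightSum c i (t + 1) ω * σ ^ 2 / 2)) with hf
    have hlab : Measurable[R.ℱ t] fun ω => c (R.label (t + 1) i ω) ^ 2 :=
      (measurable_from_nat (f := fun k => c k ^ 2)).comp (R.measurable_label t i)
    have hws : ∀ ω, R.weightSum c i (t + 1) ω =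
        R.weightSum c i t ω + c (R.label (t + 1) i ω) ^ 2 := fun ω => Finset.sum_range_succ _ _
    have hwn : ∀ ω, R.weightedNoise c i (t + 1) ω = R.weightedNoise c i t ω +
        c (R.label (t + 1) i ω) * R.noise (t + 1) i ω := fun ω => Finset.sum_range_succ _ _
    have hfm : Measurable[R.ℱ t] f := by
      have h1 := R.measurable_weightedNoise c i t
      have h2 := R.measurable_weightSum c i t
      simp only [hf, hws]
      exact (Real.measurable_exp.comp (h1.sub (((h2.add hlab).mul_const _).div_const _))).ennreal_ofReal
    have h := R.lintegral_mul_exp_noise_le c i t hfm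
    calc _ = ∫⁻ ω, f ω *
          ENNReal.ofReal (Real.exp (c (R.label (t + 1) i ω) * R.noise (t + 1) i ω)) ∂(R.P) := by
          refine lintegral_congr fun ω => ?_
          rw [hf, ← ENNReal.ofReal_mul (Real.exp_pos _).le, ← Real.exp_add, hwn]
          congr 2; ring
      _ ≤ _ := h
      _ = _ := by
          refine lintegral_congr fun ω => ?_
          rw [hf, ← ENNReal.ofReal_mul (Real.exp_pos _).le, ← Real.exp_add, hws]
          congr 2; ring
      _ ≤ 1 := ih

/-- The weighted noise is subgaussian when its variance proxy is bounded. -/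
lemma hasSubgaussianMGF_weightedNoise (c : ℕ → ℝ) (i : Fin K) (t : ℕ) {V : NNReal}
    (hV : ∀ ω, R.weightSum c i t ω * σ ^ 2 ≤ V) :
    ProbabilityTheory.HasSubgaussianMGF (R.weightedNoise c i t) V R.P := by
  have hWm : Measurable (R.weightedNoise c i t) :=
    (R.measurable_weightedNoise c i t).mono (R.ℱ.le t) le_rfl
  have key : ∀ θ : ℝ, ∫⁻ ω, ENNReal.ofReal (Real.exp (θ * R.weightedNoise c i t ω)) ∂(R.P) ≤
      ENNReal.ofReal (Real.exp (V * θ ^ 2 / 2)) := by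
    intro θ
    have h := R.lintegral_exp_weightedNoise_sub_le (fun k => θ * c k) i t
    have h1 : ∀ ω, R.weightedNoise (fun k => θ * c k) i t ω = θ * R.weightedNoise c i t ω :=
      fun ω => by simp only [weightedNoise, Finset.mul_sum, mul_assoc]
    have h2 : ∀ ω, R.weightSum (fun k => θ * c k) i t ω = θ ^ 2 * R.weightSum c i t ω :=
      fun ω => by simp only [weightSum, Finset.mul_sum, mul_pow]
    calc _ ≤ ∫⁻ ω, ENNReal.ofReal (Real.exp (V * θ ^ 2 / 2)) * ENNReal.ofReal
          (Real.exp (R.weightedNoise (fun k => θ * c k) i t ω -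
            R.weightSum (fun k => θ * c k) i t ω * σ ^ 2 / 2)) ∂(R.P) := by
          refine lintegral_mono fun ω => ?_
          rw [← ENNReal.ofReal_mul (Real.exp_pos _).le, ← Real.exp_add, h1, h2]
          refine ENNReal.ofReal_le_ofReal (Real.exp_le_exp.2 ?_)
          nlinarith [mul_le_mul_of_nonneg_left (hV ω) (sq_nonneg θ)]
      _ ≤ _ := by
          rw [lintegral_const_mul' _ _ ENNReal.ofReal_ne_top]
          exact mul_le_of_le_one_right' h
  have hint : ∀ θ : ℝ, Integrable (fun ω => Real.exp (θ * R.weightedNoise c i t ω)) R.P := by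
    intro θ
    refine ⟨by fun_prop, ?_⟩
    rw [hasFiniteIntegral_iff_ofReal (Filter.Eventually.of_forall fun _ => (Real.exp_pos _).le)]
    exact (key θ).trans_lt ENNReal.ofReal_lt_top
  refine ⟨hint, fun θ => ?_⟩
  rw [ProbabilityTheory.mgf, integral_eq_lintegral_of_nonneg_ae
    (Filter.Eventually.of_forall fun _ => (Real.exp_pos _).le) (hint θ).aestronglyMeasurable]
  exact ENNReal.toReal_le_of_le_ofReal (Real.exp_pos _).le (key θ)

end BanditRun

lemma ProbabilityTheory.HasSubgaussianMGF.measure_abs_gt_le {Ω : Type*} {m0 : MeasurableSpace Ω}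
    {P : Measure Ω} [IsProbabilityMeasure P] {W : Ω → ℝ} {V : NNReal}
    (h : HasSubgaussianMGF W V P) {b lam : ℝ} (hb : 0 ≤ b) (hbl : 2 * V * lam ≤ b ^ 2) :
    P.real {ω | b < |W ω|} ≤ 2 * Real.exp (-lam) := by
  rcases eq_or_ne V 0 with rfl | hV
  · have h0 := h.ae_eq_zero_of_hasSubgaussianMGF_zero
    have : P {ω | b < |W ω|} = 0 := by
      refine measure_mono_null (fun ω (hω : b < |W ω|) => ?_) (ae_iff.1 h0)
      intro h1
      rw [h1] at hω
      simp at hω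
      linarith
    rw [Measure.real, this]
    simp; positivity
  · have hV' : (0 : ℝ) < V := by positivity
    have hsub : {ω | b < |W ω|} ⊆ {ω | b ≤ W ω} ∪ {ω | b ≤ (-W) ω} := by
      intro ω hω
      rcases lt_abs.1 (show b < |W ω| from hω) with h | h
      · exact Or.inl h.le
      · exact Or.inr h.le
    have he : Real.exp (-b ^ 2 / (2 * V)) ≤ Real.exp (-lam) := by
      refine Real.exp_le_exp.2 ?_
      rw [div_le_iff₀ (by positivity)]
      linarith
    have h1 := h.measure_ge_le hb
    have h2 := h.neg.measure_ge_le hb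
    have h3 := (measureReal_mono hsub (by finiteness)).trans (measureReal_union_le (μ := P) _ _)
    linarith

/-! ### The estimator as weighted noise, and the deviation event. -/

/-- The coefficient of the `l`-th outcome in the sliding-window estimator of round `t` after `n`
pulls with window `h`. -/
def estimatorWeight (t n h l : ℕ) : ℝ :=
  (if l ∈ Finset.Icc (n - h + 1) n then ((h : ℝ) + (t - l)) / h ^ 2 else 0) -
    if l ∈ Finset.Icc (n - 2 * h + 1) (n - h) then ((t : ℝ) - (l + h)) / h ^ 2 else 0

lemma estimatorWeight_zero (t n h : ℕ) : estimatorWeight t n h 0 = 0 := by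
  simp [estimatorWeight]

lemma sum_estimatorWeight_mul {t n h : ℕ} (hh : 1 ≤ h) (hn : 2 * h ≤ n) (y : ℕ → ℝ) :
    ∑ l ∈ Finset.Icc 1 n, estimatorWeight t n h l * y l = (1 / (h : ℝ)) *
      ∑ l ∈ Finset.Icc (n - h + 1) n, (y l + ((t : ℝ) - l) * ((y l - y (l - h)) / h)) := by
  have hh' : (h : ℝ) ≠ 0 := by positivity
  have h1 : ∑ l ∈ Finset.Icc (n - 2 * h + 1) (n - h), ((t : ℝ) - (l + h)) / h ^ 2 * y l =
      ∑ l ∈ Finset.Icc (n - h + 1) n, ((t : ℝ) - l) / h ^ 2 * y (l - h) := by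
    refine Finset.sum_nbij' (fun l => l + h) (fun l => l - h) ?_ ?_ ?_ ?_ ?_
    · intro l hl; rw [Finset.mem_Icc] at *; omega
    · intro l hl; rw [Finset.mem_Icc] at *; omega
    · intro l hl; rw [Finset.mem_Icc] at *; omega
    · intro l hl; rw [Finset.mem_Icc] at *; omega
    · intro l hl; simp
  simp only [estimatorWeight, sub_mul, ite_mul, zero_mul, Finset.sum_sub_distrib,
    Finset.sum_ite_mem]
  rw [Finset.inter_eq_right.2 (Finset.Icc_subset_Icc (by omega) le_rfl),
    Finset.inter_eq_right.2 (Finset.Icc_subset_Icc (by omega) (by omega)), h1,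
    ← Finset.sum_sub_distrib, Finset.mul_sum]
  refine Finset.sum_congr rfl fun l _ => ?_
  field_simp
  ring

/-- With `a = t - n + h - 1 ≥ h`, the `h` recent weights are at most `2a/h²` and the `h` older ones
at most `a/h²` in absolute value, whence `5 = 4 + 1`. -/
lemma sum_estimatorWeight_sq_le {t n h : ℕ} (hh : 1 ≤ h) (hn : 2 * h ≤ n) (ht : n < t)
    (s : Finset ℕ) :
    ∑ l ∈ s, estimatorWeight t n h l ^ 2 ≤ 5 * ((t : ℝ) - n + h - 1) ^ 2 / h ^ 3 := by
  have hh' : (0 : ℝ) < h := by positivity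
  have hth : (n : ℝ) + 1 ≤ t := by exact_mod_cast ht
  set a : ℝ := (t : ℝ) - n + h - 1 with ha
  have hcard : ∀ (W : Finset ℕ) (C : ℝ), 0 ≤ C →
      ∑ l ∈ s, (if l ∈ W then C else 0) ≤ W.card * C := by
    intro W C hC
    rw [Finset.sum_ite_mem, Finset.sum_const, nsmul_eq_mul]
    exact mul_le_mul_of_nonneg_right
      (by exact_mod_cast Finset.card_le_card Finset.inter_subset_right) hC
  have key : ∀ l, estimatorWeight t n h l ^ 2 ≤
      (if l ∈ Finset.Icc (n - h + 1) n then 4 * a ^ 2 / (h : ℝ) ^ 4 else 0) +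
      if l ∈ Finset.Icc (n - 2 * h + 1) (n - h) then a ^ 2 / (h : ℝ) ^ 4 else 0 := by
    intro l
    rw [estimatorWeight]
    by_cases h1 : l ∈ Finset.Icc (n - h + 1) n
    · have h2 : l ∉ Finset.Icc (n - 2 * h + 1) (n - h) := by
        rw [Finset.mem_Icc] at *; omega
      rw [if_pos h1, if_neg h2, if_pos h1, if_neg h2, sub_zero, add_zero, div_pow, ← pow_mul]
      rw [Finset.mem_Icc] at h1
      have h3 : (l : ℝ) ≤ n := by exact_mod_cast h1.2
      have h4 : (n : ℝ) + 1 ≤ l + h := by exact_mod_cast (by omega : n + 1 ≤ l + h)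
      gcongr
      nlinarith
    · rw [if_neg h1, if_neg h1]
      split_ifs with h2
      · rw [Finset.mem_Icc] at h2
        rw [zero_sub, neg_sq, zero_add, div_pow, ← pow_mul]
        have h3 : (l : ℝ) + h ≤ n := by exact_mod_cast (by omega : l + h ≤ n)
        have h4 : (n : ℝ) + 1 ≤ l + h + h := by exact_mod_cast (by omega : n + 1 ≤ l + h + h)
        gcongr
        · linarith
        · linarith
      · simp
  calc _ ≤ _ := Finset.sum_le_sum fun l _ => key l
    _ ≤ h * (4 * a ^ 2 / (h : ℝ) ^ 4) + h * (a ^ 2 / (h : ℝ) ^ 4) := by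
        rw [Finset.sum_add_distrib]
        have e1 := hcard (Finset.Icc (n - h + 1) n) (4 * a ^ 2 / (h : ℝ) ^ 4) (by positivity)
        have e2 := hcard (Finset.Icc (n - 2 * h + 1) (n - h)) (a ^ 2 / (h : ℝ) ^ 4) (by positivity)
        rw [Nat.card_Icc, show n + 1 - (n - h + 1) = h by omega] at e1
        rw [Nat.card_Icc, show n - h + 1 - (n - 2 * h + 1) = h by omega] at e2
        exact add_le_add e1 e2
    _ = _ := by field_simp; ring

/-- The exploration bonus of round `t` after `n` pulls with window `h`. -/
def bonusValue (σ : ℝ) (t n h : ℕ) : ℝ :=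
  σ * ((t : ℝ) - n + h - 1) * Real.sqrt (10 * Real.log ((t : ℝ) ^ 3) / (h : ℝ) ^ 3)

lemma bonusValue_nonneg {σ : ℝ} (hσ : 0 ≤ σ) {t n : ℕ} (h : ℕ) (ht : n < t) :
    0 ≤ bonusValue σ t n h := by
  have : (n : ℝ) + 1 ≤ t := by exact_mod_cast ht
  have : (0 : ℝ) ≤ h := by positivity
  exact mul_nonneg (mul_nonneg hσ (by linarith)) (Real.sqrt_nonneg _)

lemma two_mul_floor_le {ε : ℝ} (hε : ε ≤ 1 / 2) (n : ℕ) : 2 * ⌊ε * n⌋₊ ≤ n := by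
  rcases le_total 0 ε with h | h
  · have h1 := Nat.floor_le (mul_nonneg h (Nat.cast_nonneg (α := ℝ) n))
    have h2 := mul_le_mul_of_nonneg_right hε (Nat.cast_nonneg (α := ℝ) n)
    have : (2 * ⌊ε * n⌋₊ : ℝ) ≤ n := by linarith
    exact_mod_cast this
  · rw [Nat.floor_of_nonpos (mul_nonpos_of_nonpos_of_nonneg h (Nat.cast_nonneg _))]
    simp

namespace BanditRun

variable {K : ℕ} {B : RisingBandit K} {σ : ℝ} (R : BanditRun.{u} B σ)

lemma pulls_succ_of_mem {i : Fin K} {t : ℕ} {ω : R.Ω} (h : i ∈ R.S (t + 1) ω) :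
    R.pulls i (t + 1) ω = R.pulls i t ω + 1 := by
  rw [pulls_succ, if_pos h]

lemma pulls_succ_of_notMem {i : Fin K} {t : ℕ} {ω : R.Ω} (h : i ∉ R.S (t + 1) ω) :
    R.pulls i (t + 1) ω = R.pulls i t ω := by
  rw [pulls_succ, if_neg h, add_zero]

lemma pullRound_pulls {i : Fin K} {t : ℕ} {ω : R.Ω} (h : i ∈ R.S (t + 1) ω) :
    R.pullRound i (R.pulls i (t + 1) ω) ω = t + 1 := by
  have hmem : t + 1 ∈ {s | R.pulls i (t + 1) ω ≤ R.pulls i s ω} := by simp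
  refine le_antisymm (Nat.sInf_le hmem) (le_csInf ⟨t + 1, hmem⟩ fun s hs => ?_)
  by_contra! hlt
  have h1 := R.pulls_mono i ω (Nat.lt_succ_iff.1 hlt)
  have h2 := R.pulls_succ_of_mem h
  simp only [Set.mem_ofPred_eq] at hs h1
  omega

open Classical in
/-- A sum over the rounds in which `i` is pulled is a sum over the pulls of `i`. -/
lemma sum_ite_mem_eq_sum_pulls (F : ℕ → ℕ → ℝ) (i : Fin K) (t : ℕ) (ω : R.Ω) :
    ∑ r ∈ Finset.range t, (if i ∈ R.S (r + 1) ω then F (R.pulls i (r + 1) ω) (r + 1) else 0) =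
      ∑ l ∈ Finset.Icc 1 (R.pulls i t ω), F l (R.pullRound i l ω) := by
  induction t with
  | zero => simp [pulls_zero]
  | succ t ih =>
    rw [Finset.sum_range_succ, ih]
    split_ifs with h
    · have h1 := R.pullRound_pulls h
      rw [R.pulls_succ_of_mem h] at h1 ⊢
      rw [Finset.sum_Icc_succ_top (by omega), h1]
    · rw [R.pulls_succ_of_notMem h, add_zero]

lemma weightedNoise_eq (c : ℕ → ℝ) (i : Fin K) (t : ℕ) (ω : R.Ω) :
    R.weightedNoise c i t ω =
      ∑ l ∈ Finset.Icc 1 (R.pulls i t ω), c l * (R.outcome i l ω - B.mean i l) := by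
  classical
  have h := R.sum_ite_mem_eq_sum_pulls (fun l r => c l * (R.X r i ω - B.mean i l)) i t ω
  simp only [outcome]
  rw [← h]
  refine Finset.sum_congr rfl fun r _ => ?_
  by_cases hm : i ∈ R.S (r + 1) ω <;> simp [noise, label, hm]

lemma weightSum_eq {c : ℕ → ℝ} (hc : c 0 = 0) (i : Fin K) (t : ℕ) (ω : R.Ω) :
    R.weightSum c i t ω = ∑ l ∈ Finset.Icc 1 (R.pulls i t ω), c l ^ 2 := by
  classical
  rw [← R.sum_ite_mem_eq_sum_pulls (fun l _ => c l ^ 2) i t ω]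
  refine Finset.sum_congr rfl fun r _ => ?_
  by_cases hm : i ∈ R.S (r + 1) ω <;> simp [label, hm, hc]

/-- Each arm passes through the counts `0, 1, …` once each, so a quantity depending only on the
count before the pull can be summed arm by arm. -/
lemma sum_sum_mem_pulls (φ : Fin K → ℕ → ℝ) (t : ℕ) (ω : R.Ω) :
    ∑ r ∈ Finset.range t, ∑ i ∈ R.S (r + 1) ω, φ i (R.pulls i r ω) =
      ∑ i, ∑ n ∈ Finset.range (R.pulls i t ω), φ i n := by
  classical
  have h : ∀ r, ∑ i ∈ R.S (r + 1) ω, φ i (R.pulls i r ω) =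
      ∑ i, if i ∈ R.S (r + 1) ω then φ i (R.pulls i (r + 1) ω - 1) else 0 := by
    intro r
    rw [Finset.sum_ite_mem, Finset.univ_inter]
    exact Finset.sum_congr rfl fun i hi => by rw [R.pulls_succ_of_mem hi, Nat.add_sub_cancel]
  simp_rw [h]
  rw [Finset.sum_comm]
  refine Finset.sum_congr rfl fun i _ => ?_
  rw [R.sum_ite_mem_eq_sum_pulls (fun l _ => φ i (l - 1)) i t ω,
    ← Finset.Ico_add_one_right_eq_Icc, Finset.sum_Ico_eq_sum_range]
  simp

lemma sum_pulls_le (t : ℕ) (ω : R.Ω) : ∑ i, (R.pulls i t ω : ℝ) ≤ B.maxSize * t := by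
  have h := R.sum_sum_mem_pulls (fun _ _ => 1) t ω
  simp only [Finset.sum_const, nsmul_eq_mul, mul_one, Finset.card_range] at h
  rw [← h]
  refine (Finset.sum_le_card_nsmul _ _ (B.maxSize : ℝ) fun r _ => ?_).trans_eq (by simp [mul_comm])
  exact_mod_cast B.card_le_maxSize (R.S_mem r ω)

lemma estimate_eq {ε : ℝ} (hε : ε ≤ 1 / 2) {i : Fin K} {t : ℕ} {ω : R.Ω}
    (hh : R.window ε i (t + 1) ω ≠ 0) :
    R.estimate ε i (t + 1) ω =
      B.trend i (t + 1) (R.pulls i t ω) (R.window ε i (t + 1) ω) +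
      R.weightedNoise (estimatorWeight (t + 1) (R.pulls i t ω) (R.window ε i (t + 1) ω)) i t ω := by
  have hn : 2 * R.window ε i (t + 1) ω ≤ R.pulls i t ω := two_mul_floor_le hε _
  rw [weightedNoise_eq, sum_estimatorWeight_mul (by omega) hn, RisingBandit.trend, ← mul_add,
    ← Finset.sum_add_distrib, estimate, Nat.add_sub_cancel]
  congr 1
  refine Finset.sum_congr rfl fun l _ => ?_
  ring

/-- In round `t + 1` the estimator of some base arm deviates by more than the bonus. -/
def deviation (ε : ℝ) (t : ℕ) : Set R.Ω :=
  ⋃ i : Fin K, ⋃ n ∈ (Finset.range (t + 1)).filter fun n : ℕ => ⌊ε * n⌋₊ ≠ 0,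
    {ω | bonusValue σ (t + 1) n ⌊ε * n⌋₊ <
      |R.weightedNoise (estimatorWeight (t + 1) n ⌊ε * n⌋₊) i t ω|}

lemma measurableSet_deviation (ε : ℝ) (t : ℕ) : MeasurableSet (R.deviation ε t) := by
  refine MeasurableSet.iUnion fun i => Finset.measurableSet_biUnion _ fun n _ => ?_
  exact measurableSet_lt measurable_const
    (((R.measurable_weightedNoise _ i t).mono (R.ℱ.le t) le_rfl).abs)

lemma abs_weightedNoise_le {ε : ℝ} {i : Fin K} {t : ℕ} {ω : R.Ω}
    (hω : ω ∉ R.deviation ε t) (hh : R.window ε i (t + 1) ω ≠ 0) :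
    |R.weightedNoise (estimatorWeight (t + 1) (R.pulls i t ω) (R.window ε i (t + 1) ω)) i t ω| ≤
      bonusValue σ (t + 1) (R.pulls i t ω) (R.window ε i (t + 1) ω) := by
  by_contra! h
  refine hω (Set.mem_iUnion.2 ⟨i, Set.mem_iUnion₂.2 ⟨R.pulls i t ω, ?_, h⟩⟩)
  exact Finset.mem_filter.2 ⟨Finset.mem_range.2 (Nat.lt_succ_of_le (R.pulls_le i t ω)), hh⟩

/-- The weights depend on the random pull count, so a union bound runs over all deterministic counts
`n ≤ t` and all arms. Each event has probability at most `2 (t+1)^(-3)`. -/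
lemma measure_deviation_le (hσ : 0 ≤ σ) {ε : ℝ} (hε : ε ≤ 1 / 2) (t : ℕ) :
    R.P.real (R.deviation ε t) ≤ 2 * K / ((t : ℝ) + 1) ^ 2 := by
  have ht : (0 : ℝ) < (t : ℝ) + 1 := by positivity
  have key : ∀ i : Fin K, ∀ n ∈ (Finset.range (t + 1)).filter fun n : ℕ => ⌊ε * n⌋₊ ≠ 0,
      R.P.real {ω | bonusValue σ (t + 1) n ⌊ε * n⌋₊ <
        |R.weightedNoise (estimatorWeight (t + 1) n ⌊ε * n⌋₊) i t ω|} ≤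
        2 * (((t : ℝ) + 1) ^ 3)⁻¹ := by
    intro i n hn
    obtain ⟨hn1, hh⟩ := Finset.mem_filter.1 hn
    have hnt := Finset.mem_range.1 hn1
    have hn2 := two_mul_floor_le hε n
    set h := ⌊ε * n⌋₊
    have hh' : (h : ℝ) ≠ 0 := by exact_mod_cast hh
    have hlog : 0 ≤ Real.log (((t + 1 : ℕ) : ℝ) ^ 3) := by
      refine Real.log_nonneg (one_le_pow₀ ?_)
      exact_mod_cast Nat.succ_pos t
    -- With this `V` one has `2 V log t³ = bonus²` exactly, which explains the `10` in the bonus.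
    set V : NNReal := ⟨5 * (((t + 1 : ℕ) : ℝ) - n + h - 1) ^ 2 / h ^ 3 * σ ^ 2, by positivity⟩
    have hsub := R.hasSubgaussianMGF_weightedNoise (estimatorWeight (t + 1) n h) i t (V := V)
      fun ω => by
        rw [R.weightSum_eq (estimatorWeight_zero _ _ _)]
        exact mul_le_mul_of_nonneg_right
          (sum_estimatorWeight_sq_le (Nat.one_le_iff_ne_zero.2 hh) hn2 hnt _) (sq_nonneg σ)
    have := hsub.measure_abs_gt_le (b := bonusValue σ (t + 1) n h)
      (lam := Real.log (((t + 1 : ℕ) : ℝ) ^ 3)) (bonusValue_nonneg hσ h hnt) (le_of_eq ?_)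
    · rwa [Real.exp_neg, Real.exp_log (by positivity), Nat.cast_succ] at this
    · rw [bonusValue, mul_pow, mul_pow, Real.sq_sqrt (by positivity)]
      change 2 * (5 * (((t + 1 : ℕ) : ℝ) - n + h - 1) ^ 2 / h ^ 3 * σ ^ 2) * _ = _
      ring
  calc _ ≤ ∑ i : Fin K, ∑ n ∈ (Finset.range (t + 1)).filter fun n : ℕ => ⌊ε * n⌋₊ ≠ 0,
          2 * (((t : ℝ) + 1) ^ 3)⁻¹ := by
        refine (measureReal_iUnion_fintype_le _).trans (Finset.sum_le_sum fun i _ => ?_)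
        exact (measureReal_biUnion_finset_le _ _).trans (Finset.sum_le_sum (key i))
    _ ≤ ∑ i : Fin K, ((t : ℝ) + 1) * (2 * (((t : ℝ) + 1) ^ 3)⁻¹) := by
        refine Finset.sum_le_sum fun i _ => ?_
        rw [Finset.sum_const, nsmul_eq_mul]
        refine mul_le_mul_of_nonneg_right ?_ (by positivity)
        exact_mod_cast (Finset.card_filter_le _ _).trans_eq (Finset.card_range _)
    _ = _ := by
        simp only [Finset.sum_const, Finset.card_univ, Fintype.card_fin, nsmul_eq_mul]
        field_simp

/-! ### Expected rewards in terms of means. -/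

/-- The expected reward of the rounds `1, …, T`, given the base arms played. -/
def meanReward (T : ℕ) (ω : R.Ω) : ℝ :=
  ∑ t ∈ Finset.range T, ∑ i ∈ R.S (t + 1) ω, B.mean i (R.pulls i (t + 1) ω)

lemma sum_mem_eq_sum_indicator (t : ℕ) (F : Fin K → R.Ω → ℝ) (ω : R.Ω) :
    ∑ i ∈ R.S t ω, F i ω = ∑ i, {ω | i ∈ R.S t ω}.indicator (F i) ω := by
  classical
  simp only [Set.indicator_apply, Set.mem_ofPred_eq]
  rw [Finset.sum_ite_mem, Finset.univ_inter]

lemma integrable_indicator_mean (t : ℕ) (i : Fin K) :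
    Integrable ({ω | i ∈ R.S (t + 1) ω}.indicator fun ω => B.mean i (R.pulls i (t + 1) ω)) R.P :=
  integrable_condExp.congr (R.X_mean t i)

lemma meanReward_eq (T : ℕ) : R.meanReward T = fun ω => ∑ t ∈ Finset.range T, ∑ i,
    {ω | i ∈ R.S (t + 1) ω}.indicator (fun ω => B.mean i (R.pulls i (t + 1) ω)) ω :=
  funext fun ω => Finset.sum_congr rfl fun t _ =>
    R.sum_mem_eq_sum_indicator (t + 1) (fun i ω => B.mean i (R.pulls i (t + 1) ω)) ω

lemma integrable_meanReward (T : ℕ) : Integrable (R.meanReward T) R.P := by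
  rw [meanReward_eq]
  exact integrable_finsetSum _ fun t _ => integrable_finsetSum _ fun i _ =>
    R.integrable_indicator_mean t i

lemma value_eq (T : ℕ) : R.value T = ∫ ω, R.meanReward T ω ∂(R.P) := by
  have h : ∀ ω, ∑ t ∈ Finset.Icc 1 T, ∑ i ∈ R.S t ω, R.X t i ω =
      ∑ t ∈ Finset.range T, ∑ i, {ω | i ∈ R.S (t + 1) ω}.indicator (R.X (t + 1) i) ω := by
    intro ω
    rw [← Finset.Ico_add_one_right_eq_Icc, Finset.sum_Ico_eq_sum_range, Nat.add_sub_cancel]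
    refine Finset.sum_congr rfl fun t _ => ?_
    rw [add_comm 1 t]
    exact R.sum_mem_eq_sum_indicator (t + 1) (R.X (t + 1)) ω
  rw [meanReward_eq]
  unfold value
  simp_rw [h]
  rw [integral_finsetSum _ fun t _ => integrable_finsetSum _ fun i _ => R.X_integrable t i,
    integral_finsetSum _ fun t _ => integrable_finsetSum _ fun i _ =>
      R.integrable_indicator_mean t i]
  refine Finset.sum_congr rfl fun t _ => ?_
  rw [integral_finsetSum _ fun i _ => R.X_integrable t i,
    integral_finsetSum _ fun i _ => R.integrable_indicator_mean t i]
  refine Finset.sum_congr rfl fun i _ => ?_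
  rw [← integral_condExp (R.ℱ.le t), integral_congr_ae (R.X_mean t i)]
  rfl

end BanditRun

lemma EReal.coe_sum_real {ι : Type*} (s : Finset ι) (f : ι → ℝ) :
    ((∑ i ∈ s, f i : ℝ) : EReal) = ∑ i ∈ s, (f i : EReal) := by
  classical
  induction s using Finset.induction_on with
  | empty => simp
  | insert i s hi ih => rw [Finset.sum_insert hi, Finset.sum_insert hi, EReal.coe_add, ih]

lemma sum_inv_succ_sq_le (T : ℕ) :
    ∑ t ∈ Finset.range T, 1 / ((t : ℝ) + 1) ^ 2 ≤ 2 * (1 - 1 / ((T : ℝ) + 1)) := by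
  induction T with
  | zero => simp
  | succ T ih =>
    rw [Finset.sum_range_succ]
    have h : 1 / ((T : ℝ) + 1) ^ 2 ≤ 2 * (1 / ((T : ℝ) + 1) - 1 / ((T : ℝ) + 1 + 1)) := by
      have e : 2 * (1 / ((T : ℝ) + 1) - 1 / ((T : ℝ) + 1 + 1)) =
          2 / (((T : ℝ) + 1) * (T + 1 + 1)) := by
        field_simp
        ring
      rw [e, div_le_div_iff₀ (by positivity) (by positivity)]
      nlinarith [Nat.cast_nonneg (α := ℝ) T]
    push_cast
    linarith

/-! ### The benchmark and the cost of a single pull. -/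

namespace RisingBandit

variable {K : ℕ} (B : RisingBandit K)

lemma maxSize_le : B.maxSize ≤ K :=
  Finset.sup_le fun S _ => (Finset.card_le_univ S).trans_eq (Fintype.card_fin K)

/-- The largest expected reward of a super arm when every base arm is at its `t`-th pull. -/
def bestReward (t : ℕ) : ℝ :=
  B.superArms.sup' B.superArms_nonempty fun S => ∑ i ∈ S, B.mean i t

lemma sum_mean_le_maxSize {S : Finset (Fin K)} (hS : S ∈ B.superArms) {t : ℕ} (ht : 1 ≤ t) :
    ∑ i ∈ S, B.mean i t ≤ B.maxSize := by
  refine (Finset.sum_le_card_nsmul _ _ 1 fun i _ => B.mean_le_one i t ht).trans ?_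
  rw [nsmul_eq_mul, mul_one]
  exact_mod_cast B.card_le_maxSize hS

lemma bestReward_le_maxSize {t : ℕ} (ht : 1 ≤ t) : B.bestReward t ≤ B.maxSize :=
  Finset.sup'_le _ _ fun _ hS => B.sum_mean_le_maxSize hS ht

/-- Upper bound for the loss caused by playing base arm `i` in round `t` after `n` pulls. -/
def cost (σ ε : ℝ) (t : ℕ) (i : Fin K) (n : ℕ) : ℝ :=
  if ⌊ε * n⌋₊ = 0 then (B.maxSize : ℝ) else
    min (B.maxSize : ℝ) (t * B.increment i (n - 2 * ⌊ε * n⌋₊ + 1)) +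
      min (B.maxSize : ℝ) (2 * bonusValue σ t n ⌊ε * n⌋₊)

lemma cost_nonneg {σ ε : ℝ} (hσ : 0 ≤ σ) {t n : ℕ} (ht : n < t) (i : Fin K) :
    0 ≤ B.cost σ ε t i n := by
  unfold cost
  have h1 := B.increment_nonneg i (n := n - 2 * ⌊ε * n⌋₊ + 1) (by omega)
  have h2 := bonusValue_nonneg hσ ⌊ε * n⌋₊ ht
  split_ifs
  · positivity
  · exact add_nonneg (le_min (by positivity) (by positivity)) (le_min (by positivity) (by positivity))

/-- The constant in front of the summed exploration bonuses. -/
def bonusConst (σ ε : ℝ) : ℝ := 2 * σ * √(240 / ε ^ 3)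

/-- A nonempty window satisfies `h ≥ εn/2`, and `t - n + h - 1 ≤ T`. The constant is `240 = 10 · 3 ·
2³`, from `log t³` and the cube of `εn/2`; the factor `T² log T` is `Q³`. -/
lemma two_mul_bonusValue_le {σ ε Q : ℝ} (hσ : 0 ≤ σ) (hε0 : 0 < ε) (hε : ε ≤ 1 / 2) {t n T : ℕ}
    (hnt : n < t) (htT : t ≤ T) (hQ : Q ^ 3 = (T : ℝ) ^ 2 * Real.log T)
    (hh : ⌊ε * n⌋₊ ≠ 0) :
    2 * bonusValue σ t n ⌊ε * n⌋₊ ≤ bonusConst σ ε * √(Q ^ 3 / (n : ℝ) ^ 3) := by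
  have h2 := two_mul_floor_le hε n
  have hfl := Nat.lt_floor_add_one (ε * n)
  set h := ⌊ε * n⌋₊
  have hh1 : 1 ≤ h := Nat.one_le_iff_ne_zero.2 hh
  have hh' : (1 : ℝ) ≤ h := by exact_mod_cast hh1
  have hn0 : (0 : ℝ) < n := by exact_mod_cast (by omega : 0 < n)
  have ht0 : (0 : ℝ) < t := by exact_mod_cast (by omega : 0 < t)
  have htT' : (t : ℝ) ≤ T := by exact_mod_cast htT
  have hhn : (h : ℝ) ≤ n := by exact_mod_cast (by omega : h ≤ n)
  have hlog : 0 ≤ Real.log T := Real.log_natCast_nonneg T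
  have h3 : ε * n / 2 ≤ h := by linarith
  have e1 : √(10 * Real.log ((t : ℝ) ^ 3) / (h : ℝ) ^ 3) ≤
      √(30 * Real.log T / (ε * n / 2) ^ 3) := by
    refine Real.sqrt_le_sqrt ?_
    rw [Real.log_pow]
    have : Real.log t ≤ Real.log T := Real.log_le_log ht0 htT'
    refine div_le_div₀ (by positivity) (by push_cast; linarith) (by positivity) ?_
    gcongr
  have e2 : (T : ℝ) * √(30 * Real.log T / (ε * n / 2) ^ 3) =
      √(240 / ε ^ 3) * √(Q ^ 3 / (n : ℝ) ^ 3) := by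
    rw [← Real.sqrt_mul (by positivity), hQ]
    nth_rewrite 1 [← Real.sqrt_sq (Nat.cast_nonneg (α := ℝ) T)]
    rw [← Real.sqrt_mul (by positivity)]
    congr 1
    field_simp
    ring
  unfold bonusValue bonusConst
  calc _ ≤ 2 * (σ * T * √(30 * Real.log T / (ε * n / 2) ^ 3)) := by
        refine mul_le_mul_of_nonneg_left ?_ two_pos.le
        exact mul_le_mul (mul_le_mul_of_nonneg_left (by linarith) hσ) e1 (Real.sqrt_nonneg _)
          (by positivity)
    _ = 2 * σ * ((T : ℝ) * √(30 * Real.log T / (ε * n / 2) ^ 3)) := by ring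
    _ = _ := by rw [e2]; ring

lemma cost_le {σ ε q Q : ℝ} (hσ : 0 ≤ σ) (hε0 : 0 < ε) (hε : ε < 1 / 2) (hq0 : 0 ≤ q)
    (hq1 : q ≤ 1) {t n T : ℕ} (hnt : n < t) (htT : t ≤ T)
    (hQ : Q ^ 3 = (T : ℝ) ^ 2 * Real.log T) (i : Fin K) :
    B.cost σ ε t i n ≤ (if ⌊ε * n⌋₊ = 0 then (B.maxSize : ℝ) else 0) +
      if 1 ≤ n then (B.maxSize : ℝ) ^ (1 - q) * (T : ℝ) ^ q *
          B.maxIncrement q (⌊(1 - 2 * ε) * n⌋₊ + 1) +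
        min (B.maxSize : ℝ) (bonusConst σ ε * √(Q ^ 3 / (n : ℝ) ^ 3)) else 0 := by
  have hL : (0 : ℝ) ≤ B.maxSize := Nat.cast_nonneg _
  have hA : 0 ≤ bonusConst σ ε := by unfold bonusConst; positivity
  have hM := B.maxIncrement_nonneg q (l := ⌊(1 - 2 * ε) * n⌋₊ + 1) (by omega)
  unfold cost
  split_ifs with hh hn hn
  · have : 0 ≤ min (B.maxSize : ℝ) (bonusConst σ ε * √(Q ^ 3 / (n : ℝ) ^ 3)) :=
      le_min hL (by positivity)
    have : 0 ≤ (B.maxSize : ℝ) ^ (1 - q) * (T : ℝ) ^ q *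
        B.maxIncrement q (⌊(1 - 2 * ε) * n⌋₊ + 1) := by positivity
    linarith
  · simp
  · rw [zero_add]
    refine add_le_add ?_ (min_le_min le_rfl
      (two_mul_bonusValue_le hσ hε0 hε.le hnt htT hQ hh))
    have h2 := two_mul_floor_le hε.le n
    -- Since `⌊εn⌋ ≤ εn`, the oldest slope used lies at or beyond `(1 - 2ε)n`; this is where the
    -- slowdown factor comes from.
    have hj : ⌊(1 - 2 * ε) * n⌋₊ + 1 ≤ n - 2 * ⌊ε * n⌋₊ + 1 := by
      refine Nat.succ_le_succ (Nat.floor_le_of_le ?_)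
      have := Nat.floor_le (mul_nonneg hε0.le (Nat.cast_nonneg (α := ℝ) n))
      rw [Nat.cast_sub h2]
      push_cast
      linarith
    have hg0 := B.increment_nonneg i (n := n - 2 * ⌊ε * n⌋₊ + 1) (by omega)
    refine (min_le_rpow_mul_rpow hL (by positivity) hq0 hq1).trans ?_
    rw [Real.mul_rpow (by positivity) hg0, mul_assoc]
    refine mul_le_mul_of_nonneg_left (mul_le_mul ?_ ?_ (by positivity) (by positivity))
      (by positivity)
    · exact Real.rpow_le_rpow (by positivity) (by exact_mod_cast htT) hq0
    · exact (Real.rpow_le_rpow hg0 (B.increment_anti i (by omega) hj) hq0).trans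
        (B.increment_rpow_le_maxIncrement q i _)
  · exact absurd (by simp [show n = 0 by omega]) hh

/-- Controls the boundary terms: an increment near pull `aLT/K` is `O(1/T)`, which cancels `T^q` and
leaves a constant independent of `T`. -/
lemma maxSize_rpow_mul_le {q a : ℝ} (hq0 : 0 ≤ q) (hq1 : q ≤ 1) (ha0 : 0 < a) (ha1 : a ≤ 1)
    (hL : 1 ≤ B.maxSize) {T : ℕ} (hT : 1 ≤ T) :
    (B.maxSize : ℝ) ^ (1 - q) * (T : ℝ) ^ q * (a * (B.maxSize * T / K))⁻¹ ^ q ≤ K * (K / a) := by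
  have hL' : (1 : ℝ) ≤ B.maxSize := by exact_mod_cast hL
  have hLK : (B.maxSize : ℝ) ≤ K := by exact_mod_cast B.maxSize_le
  have hK : (0 : ℝ) < K := by linarith
  have hT' : (0 : ℝ) < T := by exact_mod_cast hT
  have h1 : (B.maxSize : ℝ) ^ (1 - q) ≤ K :=
    (Real.rpow_le_rpow_of_exponent_le hL' (by linarith : 1 - q ≤ 1)).trans (by simpa using hLK)
  have hx : 1 ≤ K / (a * B.maxSize) := by
    rw [one_le_div (by positivity)]
    nlinarith
  have h2 : (T : ℝ) ^ q * (a * (B.maxSize * T / K))⁻¹ ^ q ≤ K / a := by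
    rw [← Real.mul_rpow (by positivity) (by positivity)]
    have e : (T : ℝ) * (a * (B.maxSize * T / K))⁻¹ = K / (a * B.maxSize) := by
      field_simp
    rw [e]
    refine (Real.rpow_le_rpow_of_exponent_le hx hq1).trans ?_
    rw [Real.rpow_one]
    exact div_le_div_of_nonneg_left hK.le ha0 (by nlinarith)
  rw [mul_assoc]
  exact mul_le_mul h1 h2 (by positivity) hK.le

end RisingBandit

lemma sum_range_ite_floor_le {ε L : ℝ} (hε : 0 < ε) (hL : 0 ≤ L) (N : ℕ) :
    ∑ n ∈ Finset.range N, (if ⌊ε * n⌋₊ = 0 then L else 0) ≤ L * (1 / ε + 1) := by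
  rw [← Finset.sum_filter, Finset.sum_const, nsmul_eq_mul, mul_comm]
  refine mul_le_mul_of_nonneg_left ?_ hL
  have hsub : (Finset.range N).filter (fun n : ℕ => ⌊ε * n⌋₊ = 0) ⊆ Finset.range ⌈1 / ε⌉₊ := by
    intro n hn
    have h := Nat.floor_eq_zero.1 (Finset.mem_filter.1 hn).2
    rw [Finset.mem_range, Nat.lt_ceil, lt_div_iff₀ hε]
    linarith
  calc _ ≤ ((⌈1 / ε⌉₊ : ℕ) : ℝ) := by
        exact_mod_cast (Finset.card_le_card hsub).trans_eq (Finset.card_range _)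
    _ ≤ _ := (Nat.ceil_lt_add_one (by positivity)).le

lemma sum_range_ite_one_eq (f : ℕ → ℝ) (N : ℕ) :
    ∑ n ∈ Finset.range N, (if 1 ≤ n then f n else 0) = ∑ n ∈ Finset.Ico 1 N, f n := by
  rw [← Finset.sum_filter]
  congr 1
  ext n
  simp [and_comm]

/-! ### Regret against the benchmark. -/

namespace BanditRun

variable {K : ℕ} {B : RisingBandit K} {σ : ℝ} (R : BanditRun.{u} B σ)

lemma meanReward_le (T : ℕ) (ω : R.Ω) :
    R.meanReward T ω ≤ ∑ t ∈ Finset.range T, B.bestReward (t + 1) := by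
  refine Finset.sum_le_sum fun t _ => ?_
  refine le_trans (Finset.sum_le_sum fun i hi => ?_)
    (Finset.le_sup' (fun S => ∑ i ∈ S, B.mean i (t + 1)) (R.S_mem t ω))
  exact B.mean_mono i (by rw [R.pulls_succ_of_mem hi]; omega) (R.pulls_le i (t + 1) ω)

lemma meanReward_nonneg (T : ℕ) (ω : R.Ω) : 0 ≤ R.meanReward T ω :=
  Finset.sum_nonneg fun _ _ => Finset.sum_nonneg fun i hi =>
    B.mean_nonneg i _ (by rw [R.pulls_succ_of_mem hi]; omega)

lemma value_le (T : ℕ) : R.value T ≤ ∑ t ∈ Finset.range T, B.bestReward (t + 1) := by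
  rw [value_eq]
  refine (integral_mono (R.integrable_meanReward T) (integrable_const _)
    (R.meanReward_le T)).trans_eq ?_
  simp

lemma bddAbove_value (B : RisingBandit K) (σ : ℝ) (T : ℕ) :
    BddAbove (Set.range fun R : BanditRun.{u} B σ => R.value T) :=
  ⟨_, Set.forall_mem_range.2 fun R => R.value_le T⟩

lemma regret_le (T : ℕ) :
    R.regret T ≤ ∑ t ∈ Finset.range T, B.bestReward (t + 1) - R.value T := by
  have : Nonempty (BanditRun.{u} B σ) := ⟨R⟩
  exact sub_le_sub_right (ciSup_le fun R' => R'.value_le T) _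

lemma regret_le_maxSize_mul (T : ℕ) : R.regret T ≤ B.maxSize * T := by
  have h1 : 0 ≤ R.value T := by
    rw [value_eq]; exact integral_nonneg (R.meanReward_nonneg T)
  have h2 : ∑ t ∈ Finset.range T, B.bestReward (t + 1) ≤ B.maxSize * T := by
    refine (Finset.sum_le_card_nsmul _ _ _ fun t _ =>
      B.bestReward_le_maxSize (Nat.le_add_left 1 t)).trans_eq ?_
    simp [mul_comm]
  linarith [R.regret_le T]

variable {R}

lemma mean_le_index {ε : ℝ} (hε : ε ≤ 1 / 2) {t : ℕ} {ω : R.Ω} (hω : ω ∉ R.deviation ε t)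
    (i : Fin K) : (B.mean i (t + 1) : EReal) ≤ R.index ε i (t + 1) ω := by
  unfold index
  split_ifs with hh
  · exact le_top
  · refine EReal.coe_le_coe_iff.2 ?_
    rw [R.estimate_eq hε hh]
    have h1 := (abs_le.1 (R.abs_weightedNoise_le hω hh)).1
    have h2 := RisingBandit.mean_le_trend (B := B) i (t := t + 1) (Nat.one_le_iff_ne_zero.2 hh)
      (two_mul_floor_le hε (R.pulls i t ω)) ((R.pulls_le i t ω).trans (Nat.le_succ t))
    have h3 : R.bonus ε i (t + 1) ω =
      bonusValue σ (t + 1) (R.pulls i t ω) (R.window ε i (t + 1) ω) := rfl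
    rw [h3]
    exact h2.trans (by linarith)

lemma estimate_add_bonus_le {ε : ℝ} (hε : ε ≤ 1 / 2) {t : ℕ} {ω : R.Ω}
    (hω : ω ∉ R.deviation ε t) {i : Fin K} (hh : R.window ε i (t + 1) ω ≠ 0) :
    R.estimate ε i (t + 1) ω + R.bonus ε i (t + 1) ω ≤ B.mean i (R.pulls i t ω) +
      ((t + 1 : ℕ) * B.increment i (R.pulls i t ω - 2 * R.window ε i (t + 1) ω + 1) +
        2 * bonusValue σ (t + 1) (R.pulls i t ω) (R.window ε i (t + 1) ω)) := by
  rw [R.estimate_eq hε hh]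
  have h1 := (abs_le.1 (R.abs_weightedNoise_le hω hh)).2
  have h2 := RisingBandit.trend_le (B := B) i (t := t + 1) (Nat.one_le_iff_ne_zero.2 hh)
    (two_mul_floor_le hε (R.pulls i t ω)) ((R.pulls_le i t ω).trans (Nat.le_succ t))
  have h3 : R.bonus ε i (t + 1) ω =
    bonusValue σ (t + 1) (R.pulls i t ω) (R.window ε i (t + 1) ω) := rfl
  rw [h3]
  refine (add_le_add (add_le_add h2 h1) le_rfl).trans_eq ?_
  ring

lemma bestReward_sub_le (hσ : 0 ≤ σ) {ε : ℝ} (hε : ε ≤ 1 / 2) (hR : R.IsCRUCB ε) {t : ℕ}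
    {ω : R.Ω} (hω : ω ∉ R.deviation ε t) :
    B.bestReward (t + 1) - ∑ i ∈ R.S (t + 1) ω, B.mean i (R.pulls i (t + 1) ω) ≤
      ∑ i ∈ R.S (t + 1) ω, B.cost σ ε (t + 1) i (R.pulls i t ω) := by
  have hL : (0 : ℝ) ≤ B.maxSize := Nat.cast_nonneg _
  have hclip : B.bestReward (t + 1) - ∑ i ∈ R.S (t + 1) ω, B.mean i (R.pulls i (t + 1) ω) ≤
      B.maxSize := by
    have h1 := B.bestReward_le_maxSize (Nat.le_add_left 1 t)
    have h2 : 0 ≤ ∑ i ∈ R.S (t + 1) ω, B.mean i (R.pulls i (t + 1) ω) :=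
      Finset.sum_nonneg fun i hi => B.mean_nonneg i _ (by rw [R.pulls_succ_of_mem hi]; omega)
    linarith
  have hlt : ∀ i, R.pulls i t ω < t + 1 := fun i => Nat.lt_succ_of_le (R.pulls_le i t ω)
  -- An arm played with an infinite index gives no comparison with the optimum; its `cost` is `L`,
  -- which pays for the whole round.
  by_cases hex : ∃ i ∈ R.S (t + 1) ω, R.window ε i (t + 1) ω = 0
  · obtain ⟨i, hi, hh⟩ := hex
    refine hclip.trans ?_
    have hi' : B.cost σ ε (t + 1) i (R.pulls i t ω) = B.maxSize := if_pos hh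
    rw [← hi']
    exact Finset.single_le_sum (f := fun i => B.cost σ ε (t + 1) i (R.pulls i t ω))
      (fun j _ => B.cost_nonneg hσ (hlt j) j) hi
  · push Not at hex
    obtain ⟨S', hS', hbest⟩ := Finset.exists_mem_eq_sup' B.superArms_nonempty
      fun S => ∑ i ∈ S, B.mean i (t + 1)
    have h1 : B.bestReward (t + 1) ≤
        ∑ i ∈ R.S (t + 1) ω, (R.estimate ε i (t + 1) ω + R.bonus ε i (t + 1) ω) := by
      rw [RisingBandit.bestReward, hbest, ← EReal.coe_le_coe_iff, EReal.coe_sum_real,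
        EReal.coe_sum_real]
      refine (Finset.sum_le_sum fun i _ => mean_le_index hε hω i).trans
        ((hR (t + 1) (by omega) ω S' hS').trans_eq ?_)
      exact Finset.sum_congr rfl fun i hi => if_neg (hex i hi)
    set x : Fin K → ℝ := fun i =>
      (t + 1 : ℕ) * B.increment i (R.pulls i t ω - 2 * R.window ε i (t + 1) ω + 1)
    set y : Fin K → ℝ := fun i =>
      2 * bonusValue σ (t + 1) (R.pulls i t ω) (R.window ε i (t + 1) ω)
    have hx : ∀ i, 0 ≤ x i := fun i =>
      mul_nonneg (Nat.cast_nonneg _) (B.increment_nonneg i (by omega))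
    have hy : ∀ i, 0 ≤ y i := fun i => mul_nonneg two_pos.le (bonusValue_nonneg hσ _ (hlt i))
    have h2 : B.bestReward (t + 1) - ∑ i ∈ R.S (t + 1) ω, B.mean i (R.pulls i (t + 1) ω) ≤
        ∑ i ∈ R.S (t + 1) ω, (x i + y i) := by
      rw [sub_le_iff_le_add, ← Finset.sum_add_distrib]
      refine h1.trans (Finset.sum_le_sum fun i hi => ?_)
      have hw : R.window ε i (t + 1) ω ≤ R.pulls i t ω := by
        have := two_mul_floor_le hε (R.pulls i t ω)
        have h' : R.window ε i (t + 1) ω = ⌊ε * R.pulls i t ω⌋₊ := rfl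
        omega
      have hm := B.mean_mono i (m := R.pulls i t ω) (n := R.pulls i (t + 1) ω)
        ((Nat.one_le_iff_ne_zero.2 (hex i hi)).trans hw) (R.pulls_mono i ω (Nat.le_succ t))
      have := estimate_add_bonus_le hε hω (hex i hi)
      simp only [x, y]
      linarith
    -- The round loses at most `L`, and clipping is subadditive, so the clip can be moved to each
    -- arm and then to each of its two terms.
    refine (le_min hclip h2).trans ((min_sum_le _ hL fun i _ => add_nonneg (hx i) (hy i)).trans ?_)
    refine Finset.sum_le_sum fun i hi => ?_
    have hc : B.cost σ ε (t + 1) i (R.pulls i t ω) =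
        min (B.maxSize : ℝ) (x i) + min (B.maxSize : ℝ) (y i) := if_neg (hex i hi)
    rw [hc]
    have := min_sum_le (Finset.univ : Finset (Fin 2)) hL (f := ![x i, y i])
      (by simp [Fin.forall_fin_two, hx i, hy i])
    simpa [Fin.sum_univ_two] using this

lemma sum_cost_le (hσ : 0 ≤ σ) {ε q Q : ℝ} (hε0 : 0 < ε) (hε : ε < 1 / 2) (hq0 : 0 ≤ q)
    (hq1 : q ≤ 1) (hL : 1 ≤ B.maxSize) {T : ℕ} (hT : 1 ≤ T)
    (hQ : Q ^ 3 = (T : ℝ) ^ 2 * Real.log T) (hQ1 : 1 ≤ Q) (ω : R.Ω) :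
    ∑ t ∈ Finset.range T, ∑ i ∈ R.S (t + 1) ω, B.cost σ ε (t + 1) i (R.pulls i t ω) ≤
      K * (K * (1 / ε + 1)) +
      ((B.maxSize : ℝ) ^ (1 - q) * (K * (T : ℝ) ^ q * (1 / (1 - 2 * ε))
              * B.cumIncrement ((1 - 2 * ε) * (B.maxSize * T / K)) q) +
        K * (K / (1 - 2 * ε)) * (K / (1 - 2 * ε) + K)) +
      K * ((2 * K + 2 * RisingBandit.bonusConst σ ε) * Q) := by
  have hL0 : (0 : ℝ) ≤ B.maxSize := Nat.cast_nonneg _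
  have hL' : (1 : ℝ) ≤ B.maxSize := by exact_mod_cast hL
  have hLK : (B.maxSize : ℝ) ≤ K := by exact_mod_cast B.maxSize_le
  have hK0 : (0 : ℝ) < K := by linarith
  have hT0 : (0 : ℝ) < T := by exact_mod_cast hT
  have ha0 : 0 < 1 - 2 * ε := by linarith
  have hA : 0 ≤ RisingBandit.bonusConst σ ε := by unfold RisingBandit.bonusConst; positivity
  set D : ℝ := (B.maxSize : ℝ) ^ (1 - q) * (T : ℝ) ^ q with hD
  have hD0 : 0 ≤ D := by positivity
  set f : ℕ → ℝ := fun n => B.maxIncrement q (⌊(1 - 2 * ε) * n⌋₊ + 1) with hf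
  set g : ℕ → ℝ := fun n =>
    min (B.maxSize : ℝ) (RisingBandit.bonusConst σ ε * √(Q ^ 3 / (n : ℝ) ^ 3)) with hg
  have hf0 : ∀ n, 0 ≤ f n := fun n => B.maxIncrement_nonneg q (by omega)
  have hfIco : ∀ N, ∑ n ∈ Finset.Ico 1 N, f n ≤ ∑ n ∈ Finset.range N, f (n + 1) := by
    intro N
    rw [Finset.sum_Ico_eq_sum_range]
    simp_rw [add_comm 1]
    exact Finset.sum_le_sum_of_subset_of_nonneg
      (Finset.range_subset_range.2 (Nat.sub_le N 1)) fun n _ _ => hf0 _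
  have hmain := B.sum_maxIncrement_le (by exact_mod_cast hK0) hq0 ha0
    (x := B.maxSize * T) (by positivity) (fun i => R.pulls i T ω) (R.sum_pulls_le T ω)
  have hexc := B.maxSize_rpow_mul_le hq0 hq1 ha0 (by linarith) hL hT
  -- A bound for the cost that involves `T` instead of the current round, as needed to sum over
  -- pulls.
  set φ : ℕ → ℝ := fun n => (if ⌊ε * n⌋₊ = 0 then (B.maxSize : ℝ) else 0) +
    if 1 ≤ n then D * f n + g n else 0 with hφ
  calc _ ≤ ∑ t ∈ Finset.range T, ∑ i ∈ R.S (t + 1) ω, φ (R.pulls i t ω) := by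
        refine Finset.sum_le_sum fun t ht => Finset.sum_le_sum fun i _ => ?_
        exact B.cost_le hσ hε0 hε hq0 hq1 (Nat.lt_succ_of_le (R.pulls_le i t ω))
          (Finset.mem_range.1 ht) hQ i
    _ = ∑ i, ∑ n ∈ Finset.range (R.pulls i T ω), φ n :=
        R.sum_sum_mem_pulls (fun _ => φ) T ω
    _ ≤ ∑ i, (K * (1 / ε + 1) + D * ∑ n ∈ Finset.range (R.pulls i T ω), f (n + 1) +
          (2 * K + 2 * RisingBandit.bonusConst σ ε) * Q) := by
        refine Finset.sum_le_sum fun i _ => ?_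
        rw [hφ, Finset.sum_add_distrib, sum_range_ite_one_eq, Finset.sum_add_distrib,
          ← Finset.mul_sum, ← add_assoc]
        refine add_le_add (add_le_add ?_ (mul_le_mul_of_nonneg_left (hfIco _) hD0)) ?_
        · exact (sum_range_ite_floor_le hε0 hL0 _).trans
            (mul_le_mul_of_nonneg_right hLK (by positivity))
        · refine (sum_min_sqrt_le hL0 hA hQ1 _).trans ?_
          exact mul_le_mul_of_nonneg_right (by linarith) (by linarith)
    _ = K * (K * (1 / ε + 1)) + D * ∑ i, ∑ n ∈ Finset.range (R.pulls i T ω), f (n + 1) +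
          K * ((2 * K + 2 * RisingBandit.bonusConst σ ε) * Q) := by
        rw [Finset.sum_add_distrib, Finset.sum_add_distrib]
        simp only [Finset.sum_const, Finset.card_univ, Fintype.card_fin, nsmul_eq_mul]
        rw [← Finset.mul_sum]
    _ ≤ _ := by
        refine add_le_add (add_le_add le_rfl ?_) le_rfl
        refine (mul_le_mul_of_nonneg_left hmain hD0).trans ?_
        have h1 := mul_le_mul_of_nonneg_right hexc
          (by positivity : 0 ≤ K / (1 - 2 * ε) + (K : ℝ))
        rw [mul_add]
        refine add_le_add (le_of_eq ?_) (le_trans (le_of_eq ?_) h1)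
        · rw [hD]; ring
        · rw [hD]; ring

lemma regret_le_of_isCRUCB (hσ : 0 ≤ σ) {ε c : ℝ} (hε : ε ≤ 1 / 2) (hR : R.IsCRUCB ε) {T : ℕ}
    (hc : ∀ ω, ∑ t ∈ Finset.range T, ∑ i ∈ R.S (t + 1) ω,
      B.cost σ ε (t + 1) i (R.pulls i t ω) ≤ c) :
    R.regret T ≤ 4 * K ^ 2 + c := by
  have hL0 : (0 : ℝ) ≤ B.maxSize := Nat.cast_nonneg _
  have hLK : (B.maxSize : ℝ) ≤ K := by exact_mod_cast B.maxSize_le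
  -- Every bad round is charged the maximal loss `L ≤ K`; the expected total is at most `2K · K · ∑
  -- 1/t² ≤ 4K²`.
  set G : R.Ω → ℝ := fun ω => ∑ t ∈ Finset.range T,
    (R.deviation ε t).indicator (fun _ => (B.maxSize : ℝ)) ω with hG
  have hGi : ∀ t, Integrable ((R.deviation ε t).indicator fun _ => (B.maxSize : ℝ)) R.P :=
    fun t => (integrable_const _).indicator (R.measurableSet_deviation ε t)
  have hGint : Integrable G R.P := integrable_finsetSum _ fun t _ => hGi t
  have hpath : ∀ ω, ∑ t ∈ Finset.range T, B.bestReward (t + 1) - c - G ω ≤ R.meanReward T ω := by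
    intro ω
    suffices h : ∑ t ∈ Finset.range T, B.bestReward (t + 1) - R.meanReward T ω ≤ G ω +
        ∑ t ∈ Finset.range T, ∑ i ∈ R.S (t + 1) ω, B.cost σ ε (t + 1) i (R.pulls i t ω) by
      linarith [hc ω]
    rw [meanReward, ← Finset.sum_sub_distrib, hG, ← Finset.sum_add_distrib]
    refine Finset.sum_le_sum fun t _ => ?_
    by_cases hω : ω ∈ R.deviation ε t
    · rw [Set.indicator_of_mem hω]
      have h1 := B.bestReward_le_maxSize (Nat.le_add_left 1 t)
      have h2 : 0 ≤ ∑ i ∈ R.S (t + 1) ω, B.mean i (R.pulls i (t + 1) ω) :=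
        Finset.sum_nonneg fun i hi => B.mean_nonneg i _ (by rw [R.pulls_succ_of_mem hi]; omega)
      have h3 : 0 ≤ ∑ i ∈ R.S (t + 1) ω, B.cost σ ε (t + 1) i (R.pulls i t ω) :=
        Finset.sum_nonneg fun i _ => B.cost_nonneg hσ (Nat.lt_succ_of_le (R.pulls_le i t ω)) i
      linarith
    · rw [Set.indicator_of_notMem hω, zero_add]
      exact bestReward_sub_le hσ hε hR hω
  have hint : ∫ ω, (∑ t ∈ Finset.range T, B.bestReward (t + 1) - c - G ω) ∂(R.P) ≤
      ∫ ω, R.meanReward T ω ∂(R.P) := integral_mono ((integrable_const _).sub hGint) (R.integrable_meanReward T) hpath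
  have hGle : ∫ ω, G ω ∂(R.P) ≤ 4 * K ^ 2 := by
    rw [hG, integral_finsetSum _ fun t _ => hGi t]
    calc _ ≤ ∑ t ∈ Finset.range T, 2 * (K : ℝ) ^ 2 * (1 / ((t : ℝ) + 1) ^ 2) := by
          refine Finset.sum_le_sum fun t _ => ?_
          rw [integral_indicator_const _ (R.measurableSet_deviation ε t), smul_eq_mul]
          refine (mul_le_mul (R.measure_deviation_le hσ hε t) hLK hL0 (by positivity)).trans_eq ?_
          ring
      _ ≤ 2 * (K : ℝ) ^ 2 * (2 * (1 - 1 / ((T : ℝ) + 1))) := by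
          rw [← Finset.mul_sum]
          exact mul_le_mul_of_nonneg_left (sum_inv_succ_sq_le T) (by positivity)
      _ ≤ _ := by
          have : 0 ≤ 1 / ((T : ℝ) + 1) := by positivity
          nlinarith [sq_nonneg (K : ℝ)]
  have e : ∫ ω, (∑ t ∈ Finset.range T, B.bestReward (t + 1) - c - G ω) ∂(R.P) =
      ∑ t ∈ Finset.range T, B.bestReward (t + 1) - c - ∫ ω, G ω ∂(R.P) := by
    rw [integral_sub (integrable_const _) hGint]
    simp
  rw [e, ← value_eq] at hint
  linarith [R.regret_le T]

end BanditRun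

/-! ### The rate `Q` and the final constants. -/

lemma rate_pow_three (T : ℕ) :
    ((T : ℝ) ^ (2 / 3 : ℝ) * Real.log T ^ (1 / 3 : ℝ)) ^ 3 = (T : ℝ) ^ 2 * Real.log T := by
  rw [mul_pow, ← Real.rpow_mul_natCast (Nat.cast_nonneg T),
    ← Real.rpow_mul_natCast (Real.log_natCast_nonneg T)]
  norm_num

lemma one_le_rate {T : ℕ} (hT : 2 ≤ T) :
    1 ≤ (T : ℝ) ^ (2 / 3 : ℝ) * Real.log T ^ (1 / 3 : ℝ) := by
  have hT' : (2 : ℝ) ≤ T := by exact_mod_cast hT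
  have hlog : 0 ≤ Real.log T := Real.log_natCast_nonneg T
  by_contra! h
  have h1 := pow_lt_one₀ (by positivity) h (n := 3) (by norm_num)
  rw [rate_pow_three] at h1
  have h2 : Real.log 2 ≤ Real.log T := Real.log_le_log two_pos hT'
  have h3 := Real.log_two_gt_d9
  nlinarith

end

theorem mainTheorem2 (K : ℕ) (σ : ℝ) (hσ : 0 ≤ σ) (ε : ℝ) (hε0 : 0 < ε) (hε : ε < 1 / 2) :
    ∃ C : ℝ, ∀ (B : RisingBandit K) (R : BanditRun.{u} B σ), R.IsCRUCB ε →
      ∀ (T : ℕ) (q : ℝ), 0 ≤ q → q ≤ 1 →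
        BddAbove (Set.range fun R' : BanditRun.{u} B σ => R'.value T) ∧
        R.regret T ≤
          (B.maxSize : ℝ) * Real.pi * K / 3 + 2 * K
          + (B.maxSize : ℝ) ^ (1 - q) * (K * (T : ℝ) ^ q * (1 / (1 - 2 * ε))
              * B.cumIncrement ((1 - 2 * ε) * (B.maxSize * T / K)) q)
          + C * ((T : ℝ) ^ (2 / 3 : ℝ) * Real.log T ^ (1 / 3 : ℝ)) := by
  have ha0 : 0 < 1 - 2 * ε := by linarith
  have hA : 0 ≤ RisingBandit.bonusConst σ ε := by unfold RisingBandit.bonusConst; positivity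
  set c₁ : ℝ := 4 * K ^ 2 + K * (K * (1 / ε + 1)) +
    K * (K / (1 - 2 * ε)) * (K / (1 - 2 * ε) + K) with hc₁
  set c₂ : ℝ := K * (2 * K + 2 * RisingBandit.bonusConst σ ε) with hc₂
  have hc₁0 : 0 ≤ c₁ := by positivity
  have hc₂0 : 0 ≤ c₂ := by positivity
  refine ⟨c₁ + c₂, fun B R hR T q hq0 hq1 => ⟨BanditRun.bddAbove_value B σ T, ?_⟩⟩
  have hLK : (B.maxSize : ℝ) ≤ K := by exact_mod_cast B.maxSize_le
  have hΥ := B.cumIncrement_nonneg ((1 - 2 * ε) * (B.maxSize * T / K)) q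
  have hlog : 0 ≤ Real.log T := Real.log_natCast_nonneg T
  have hπ : 0 ≤ (B.maxSize : ℝ) * Real.pi * K / 3 := by positivity
  -- For `T ≤ 1` the logarithm, hence the rate, is zero and `C` cannot help; the regret is then at
  -- most `L T ≤ K`, which `2K` covers.
  by_cases htriv : T ≤ 1 ∨ B.maxSize = 0
  · have h1 : (B.maxSize : ℝ) * T ≤ K := by
      rcases htriv with h | h
      · have : (T : ℝ) ≤ 1 := by exact_mod_cast h
        have := mul_le_mul_of_nonneg_left this (Nat.cast_nonneg (α := ℝ) B.maxSize)
        linarith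
      · simp [h]
    have h2 : 0 ≤ (B.maxSize : ℝ) ^ (1 - q) * (K * (T : ℝ) ^ q * (1 / (1 - 2 * ε))
        * B.cumIncrement ((1 - 2 * ε) * (B.maxSize * T / K)) q) := by positivity
    have h3 : 0 ≤ (c₁ + c₂) * ((T : ℝ) ^ (2 / 3 : ℝ) * Real.log T ^ (1 / 3 : ℝ)) := by positivity
    linarith [R.regret_le_maxSize_mul T, Nat.cast_nonneg (α := ℝ) K]
  · push Not at htriv
    have hQ1 := one_le_rate (T := T) (by omega)
    have h := BanditRun.regret_le_of_isCRUCB hσ hε.le hR (T := T) fun ω =>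
      BanditRun.sum_cost_le hσ hε0 hε hq0 hq1 (Nat.one_le_iff_ne_zero.2 htriv.2) (by omega)
        (rate_pow_three T) hQ1 ω
    set Q := (T : ℝ) ^ (2 / 3 : ℝ) * Real.log T ^ (1 / 3 : ℝ)
    -- The constant part `c₁` is absorbed into `c₁ Q` because `Q ≥ 1`.
    have h2 := mul_le_mul_of_nonneg_left hQ1 hc₁0
    have h3 : K * ((2 * K + 2 * RisingBandit.bonusConst σ ε) * Q) = c₂ * Q := by rw [hc₂]; ring
    rw [h3] at h
    linarith [Nat.cast_nonneg (α := ℝ) K]
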